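/- Let $\mathbb F$ be an algebraically closed field. Let $\mathrm{AGL}_4(\mathbb F)$ be the group of invertible $5\times5$ matrices over $\mathbb F$ with first column $(1,0,0,0,0)^{\mathrm T}$, acting on the right on the row vectors $(1,v)$, $v\in\mathbb F^4$. A subgroup $R\le \mathrm{AGL}_4(\mathbb F)$ is called regular if for every $v\in\mathbb F^4$ there is exactly one element of $R$ whose first row is $(1,v)$. Conjugacy of subgroups means conjugacy in $\mathrm{AGL}_4(\mathbb F)$. For $\alpha,\beta\in\mathbb F$ and $D\in\mathrm{Mat}_3(\mathbb F)$ consider the following sets of matrices, where $x_1,x_2,x_3,x_4$ run over $\mathbb F$ and $X=(x_1,x_2,x_3)$: $$S_{(5)}=\begin{pmatrix}1&x_1&x_2&x_3&x_4\\0&1&x_1&x_2&x_3\\0&0&1&x_1&x_2\\0&0&0&1&x_1\\0&0&0&0&1\end{pmatrix},\quad S_{(4,1)}=\begin{pmatrix}1&x_1&x_2&x_3&x_4\\0&1&x_1&x_2&0\\0&0&1&x_1&0\\0&0&0&1&0\\0&0&0&0&1\end{pmatrix},\quad S_{(3,2)}^{\sharp}=\begin{pmatrix}1&x_1&x_2&x_3&x_4\\0&1&x_1&0&x_2\\0&0&1&0&x_1\\0&0&0&1&x_3\\0&0&0&0&1\end{pmatrix},$$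 $$U_1(\alpha,\beta)=\begin{pmatrix}1&x_1&x_2&x_3&x_4\\0&1&0&x_1&x_2\\0&0&1&\beta x_2&x_1+\alpha x_2\\0&0&0&1&0\\0&0&0&0&1\end{pmatrix},\quad \mathrm R_D=\begin{pmatrix}1&X&x_4\\0&I_3&DX^{\mathrm T}\\0&0&1\end{pmatrix},\quad \mathrm{Tr}_4=\mathrm R_0 .$$ Let $E_{i,j}\in\mathrm{Mat}_3(\mathbb F)$ be the matrix with $1$ at position $(i,j)$ and $0$ elsewhere. If $\operatorname{char}\mathbb F\neq2$, there are exactly $9$ conjugacy classes of abelian regular subgroups of $\mathrm{AGL}_4(\mathbb F)$, and they are represented by the following subgroups, which are abelian and regular (that is, every abelian regular subgroup is conjugate to exactly one of them): $$S_{(5)},\ S_{(4,1)},\ S_{(3,2)}^\sharp,\ U_1(0,0),\ U_1(0,1),\ \mathrm R_{E_{1,1}},\ \mathrm R_{E_{1,1}+E_{2,2}},\ \mathrm R_{I_3},\ \mathrm{Tr}_4.$$ If $\operatorname{char}\mathbb F=2$, there are exactly $10$ conjugacy classes of abelian regular subgroups of $\mathrm{AGL}_4(\mathbb F)$, and they are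 represented by the following subgroups, which are abelian and regular (that is, every abelian regular subgroup is conjugate to exactly one of them): $$S_{(5)},\ S_{(4,1)},\ S_{(3,2)}^\sharp,\ U_1(0,0),\ U_1(1,0),\ \mathrm R_{E_{1,1}},\ \mathrm R_{E_{1,1}+E_{2,2}},\ \mathrm R_{E_{2,3}+E_{3,2}},\ \mathrm R_{I_3},\ \mathrm{Tr}_4.$$ -/

import Mathlib

/-- The affine group `AGL_n(F)`: the invertible `(n+1) × (n+1)` matrices over `F` whose first
column is `(1, 0, …, 0)ᵀ`. It acts on the right on the affine points, i.e. on the row vectors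
`(1, v)` with `v ∈ F ^ n`. -/
def AGL (n : ℕ) (F : Type*) [Field F] : Subgroup (GL (Fin (n + 1)) F) where
  carrier := {g | ∀ i, (g : Matrix (Fin (n + 1)) (Fin (n + 1)) F) i 0 = if i = 0 then 1 else 0}
  one_mem' := by
    intro i
    simp [Matrix.one_apply]
  mul_mem' := by
    intro a b ha hb i
    simp only [Set.mem_ofPred_eq] at ha hb
    simp [Matrix.mul_apply, hb, ha]
  inv_mem' := by
    intro g hg i
    simp only [Set.mem_ofPred_eq] at hg
    have h : (((g⁻¹ * g : GL (Fin (n + 1)) F)) : Matrix (Fin (n + 1)) (Fin (n + 1)) F) i 0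
        = if i = 0 then 1 else 0 := by
      rw [inv_mul_cancel]
      simp [Matrix.one_apply]
    rw [Units.val_mul, Matrix.mul_apply] at h
    simpa [hg] using h

/-- The underlying `(n+1) × (n+1)` matrix of an element of `AGL_n(F)`. -/
def aglMatrix {n : ℕ} {F : Type*} [Field F] (g : AGL n F) :
    Matrix (Fin (n + 1)) (Fin (n + 1)) F :=
  ((g : GL (Fin (n + 1)) F) : Matrix (Fin (n + 1)) (Fin (n + 1)) F)

theorem aglMatrix_mul {n : ℕ} {F : Type*} [Field F] (g h : AGL n F) :
    aglMatrix (g * h) = aglMatrix g * aglMatrix h := rfl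

theorem aglMatrix_one {n : ℕ} {F : Type*} [Field F] :
    aglMatrix (1 : AGL n F) = 1 := rfl

/-- A subgroup `R` of `AGL_n(F)` is regular if for every `v ∈ F ^ n` there is a unique element
of `R` whose first row is `(1, v)`. -/
def IsRegularSubgroup {n : ℕ} {F : Type*} [Field F] (R : Subgroup (AGL n F)) : Prop :=
  ∀ v : Fin n → F, ∃! g : AGL n F, g ∈ R ∧ aglMatrix g 0 = (Fin.cons 1 v : Fin (n + 1) → F)

/-- A subgroup of `AGL_n(F)` that is abelian and regular. -/
def IsAbelianRegular {n : ℕ} {F : Type*} [Field F] (R : Subgroup (AGL n F)) : Prop :=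
  (∀ a ∈ R, ∀ b ∈ R, a * b = b * a) ∧ IsRegularSubgroup R

/-- Two subgroups of a group `G` are conjugate (in `G`). -/
def IsConjSubgroup {G : Type*} [Group G] (R S : Subgroup G) : Prop :=
  ∃ g : G, R.map (MulAut.conj g).toMonoidHom = S

/-- The set of all conjugacy classes of abelian regular subgroups of `AGL_n(F)`. -/
def abelianRegularClasses (n : ℕ) (F : Type*) [Field F] : Set (Set (Subgroup (AGL n F))) :=
  {C | ∃ R : Subgroup (AGL n F), IsAbelianRegular R ∧ C = {S | IsConjSubgroup R S}}

/-- The family of subgroups `L` is a complete and irredundant list of representatives of the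
conjugacy classes of abelian regular subgroups of `AGL_n(F)`. -/
def RepresentsAbelianRegularClasses {n : ℕ} {F : Type*} [Field F] {ι : Type*}
    (L : ι → Subgroup (AGL n F)) : Prop :=
  (∀ i, IsAbelianRegular (L i)) ∧
    ∀ R : Subgroup (AGL n F), IsAbelianRegular R → ∃! i, IsConjSubgroup R (L i)

/-- The subgroup of `AGL_4(F)` that consists of the matrices `M x₁ x₂ x₃ x₄`. -/
def paramSubgroup {F : Type*} [Field F] (M : F → F → F → F → Matrix (Fin 5) (Fin 5) F)
    (hone : ∃ x₁ x₂ x₃ x₄, 1 = M x₁ x₂ x₃ x₄)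
    (hmul : ∀ x₁ x₂ x₃ x₄ y₁ y₂ y₃ y₄, ∃ z₁ z₂ z₃ z₄,
      M x₁ x₂ x₃ x₄ * M y₁ y₂ y₃ y₄ = M z₁ z₂ z₃ z₄)
    (hinv : ∀ x₁ x₂ x₃ x₄, ∃ y₁ y₂ y₃ y₄, M x₁ x₂ x₃ x₄ * M y₁ y₂ y₃ y₄ = 1) :
    Subgroup (AGL 4 F) where
  carrier := {g | ∃ x₁ x₂ x₃ x₄ : F, aglMatrix g = M x₁ x₂ x₃ x₄}
  one_mem' := hone
  mul_mem' := by
    rintro a b ⟨x₁, x₂, x₃, x₄, ha⟩ ⟨y₁, y₂, y₃, y₄, hb⟩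
    obtain ⟨z₁, z₂, z₃, z₄, h⟩ := hmul x₁ x₂ x₃ x₄ y₁ y₂ y₃ y₄
    exact ⟨z₁, z₂, z₃, z₄, by rw [aglMatrix_mul, ha, hb, h]⟩
  inv_mem' := by
    rintro a ⟨x₁, x₂, x₃, x₄, ha⟩
    obtain ⟨y₁, y₂, y₃, y₄, h⟩ := hinv x₁ x₂ x₃ x₄
    refine ⟨y₁, y₂, y₃, y₄, ?_⟩
    have h1 : aglMatrix a⁻¹ * aglMatrix a = 1 := by
      rw [← aglMatrix_mul, inv_mul_cancel, aglMatrix_one]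
    calc aglMatrix a⁻¹ = aglMatrix a⁻¹ * (aglMatrix a * M y₁ y₂ y₃ y₄) := by
          rw [ha, h, mul_one]
      _ = M y₁ y₂ y₃ y₄ := by rw [← mul_assoc, h1, one_mul]

/-- The subgroup `S_(5)` of `AGL_4(F)`. -/
def subgroupS5 (F : Type*) [Field F] : Subgroup (AGL 4 F) :=
  paramSubgroup (fun x₁ x₂ x₃ x₄ =>
      !![1, x₁, x₂, x₃, x₄;
         0, 1, x₁, x₂, x₃;
         0, 0, 1, x₁, x₂;
         0, 0, 0, 1, x₁;
         0, 0, 0, 0, 1])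
    ⟨0, 0, 0, 0, by ext i j; fin_cases i <;> fin_cases j <;> rfl⟩
    (fun x₁ x₂ x₃ x₄ y₁ y₂ y₃ y₄ =>
      ⟨x₁ + y₁, x₂ + y₂ + x₁ * y₁, x₃ + y₃ + x₁ * y₂ + x₂ * y₁,
        x₄ + y₄ + x₁ * y₃ + x₂ * y₂ + x₃ * y₁, by
        ext i j
        fin_cases i <;> fin_cases j <;> simp [Matrix.mul_apply, Fin.sum_univ_succ] <;> ring⟩)
    (fun x₁ x₂ x₃ x₄ =>
      ⟨-x₁, -x₂ + x₁ ^ 2, -x₃ + 2 * x₁ * x₂ - x₁ ^ 3,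
        -x₄ + 2 * x₁ * x₃ + x₂ ^ 2 - 3 * x₁ ^ 2 * x₂ + x₁ ^ 4, by
        ext i j
        fin_cases i <;> fin_cases j <;> simp [Matrix.mul_apply, Fin.sum_univ_succ] <;> ring⟩)

/-- The subgroup `S_(4,1)` of `AGL_4(F)`. -/
def subgroupS41 (F : Type*) [Field F] : Subgroup (AGL 4 F) :=
  paramSubgroup (fun x₁ x₂ x₃ x₄ =>
      !![1, x₁, x₂, x₃, x₄;
         0, 1, x₁, x₂, 0;
         0, 0, 1, x₁, 0;
         0, 0, 0, 1, 0;
         0, 0, 0, 0, 1])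
    ⟨0, 0, 0, 0, by ext i j; fin_cases i <;> fin_cases j <;> rfl⟩
    (fun x₁ x₂ x₃ x₄ y₁ y₂ y₃ y₄ =>
      ⟨x₁ + y₁, x₂ + y₂ + x₁ * y₁, x₃ + y₃ + x₁ * y₂ + x₂ * y₁, x₄ + y₄, by
        ext i j
        fin_cases i <;> fin_cases j <;> simp [Matrix.mul_apply, Fin.sum_univ_succ] <;> ring⟩)
    (fun x₁ x₂ x₃ x₄ =>
      ⟨-x₁, -x₂ + x₁ ^ 2, -x₃ + 2 * x₁ * x₂ - x₁ ^ 3, -x₄, by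
        ext i j
        fin_cases i <;> fin_cases j <;> simp [Matrix.mul_apply, Fin.sum_univ_succ] <;> ring⟩)

/-- The subgroup `S_(3,2)^♯` of `AGL_4(F)`. -/
def subgroupS32sharp (F : Type*) [Field F] : Subgroup (AGL 4 F) :=
  paramSubgroup (fun x₁ x₂ x₃ x₄ =>
      !![1, x₁, x₂, x₃, x₄;
         0, 1, x₁, 0, x₂;
         0, 0, 1, 0, x₁;
         0, 0, 0, 1, x₃;
         0, 0, 0, 0, 1])
    ⟨0, 0, 0, 0, by ext i j; fin_cases i <;> fin_cases j <;> rfl⟩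
    (fun x₁ x₂ x₃ x₄ y₁ y₂ y₃ y₄ =>
      ⟨x₁ + y₁, x₂ + y₂ + x₁ * y₁, x₃ + y₃, x₄ + y₄ + x₁ * y₂ + x₂ * y₁ + x₃ * y₃, by
        ext i j
        fin_cases i <;> fin_cases j <;> simp [Matrix.mul_apply, Fin.sum_univ_succ] <;> ring⟩)
    (fun x₁ x₂ x₃ x₄ =>
      ⟨-x₁, -x₂ + x₁ ^ 2, -x₃, -x₄ + 2 * x₁ * x₂ - x₁ ^ 3 + x₃ ^ 2, by
        ext i j
        fin_cases i <;> fin_cases j <;> simp [Matrix.mul_apply, Fin.sum_univ_succ] <;> ring⟩)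

/-- The subgroup `U_1(α, β)` of `AGL_4(F)`. -/
def subgroupU1 {F : Type*} [Field F] (α β : F) : Subgroup (AGL 4 F) :=
  paramSubgroup (fun x₁ x₂ x₃ x₄ =>
      !![1, x₁, x₂, x₃, x₄;
         0, 1, 0, x₁, x₂;
         0, 0, 1, β * x₂, x₁ + α * x₂;
         0, 0, 0, 1, 0;
         0, 0, 0, 0, 1])
    ⟨0, 0, 0, 0, by ext i j; fin_cases i <;> fin_cases j <;> simp⟩
    (fun x₁ x₂ x₃ x₄ y₁ y₂ y₃ y₄ =>
      ⟨x₁ + y₁, x₂ + y₂, x₃ + y₃ + x₁ * y₁ + β * x₂ * y₂,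
        x₄ + y₄ + x₁ * y₂ + x₂ * y₁ + α * x₂ * y₂, by
        ext i j
        fin_cases i <;> fin_cases j <;> simp [Matrix.mul_apply, Fin.sum_univ_succ] <;> ring⟩)
    (fun x₁ x₂ x₃ x₄ =>
      ⟨-x₁, -x₂, -x₃ + x₁ ^ 2 + β * x₂ ^ 2, -x₄ + 2 * x₁ * x₂ + α * x₂ ^ 2, by
        ext i j
        fin_cases i <;> fin_cases j <;> simp [Matrix.mul_apply, Fin.sum_univ_succ] <;> ring⟩)

/-- The subgroup `R_D` of `AGL_4(F)`, where `D` is a `3 × 3` matrix: its elements are the block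
matrices with rows `(1, X, x₄)`, `(0, I₃, D Xᵀ)`, `(0, 0, 1)`, where `X = (x₁, x₂, x₃)`. -/
def subgroupRD {F : Type*} [Field F] (D : Matrix (Fin 3) (Fin 3) F) : Subgroup (AGL 4 F) :=
  paramSubgroup (fun x₁ x₂ x₃ x₄ =>
      !![1, x₁, x₂, x₃, x₄;
         0, 1, 0, 0, D 0 0 * x₁ + D 0 1 * x₂ + D 0 2 * x₃;
         0, 0, 1, 0, D 1 0 * x₁ + D 1 1 * x₂ + D 1 2 * x₃;
         0, 0, 0, 1, D 2 0 * x₁ + D 2 1 * x₂ + D 2 2 * x₃;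
         0, 0, 0, 0, 1])
    ⟨0, 0, 0, 0, by ext i j; fin_cases i <;> fin_cases j <;> simp⟩
    (fun x₁ x₂ x₃ x₄ y₁ y₂ y₃ y₄ =>
      ⟨x₁ + y₁, x₂ + y₂, x₃ + y₃, x₄ + y₄
          + x₁ * (D 0 0 * y₁ + D 0 1 * y₂ + D 0 2 * y₃)
          + x₂ * (D 1 0 * y₁ + D 1 1 * y₂ + D 1 2 * y₃)
          + x₃ * (D 2 0 * y₁ + D 2 1 * y₂ + D 2 2 * y₃), by
        ext i j
        fin_cases i <;> fin_cases j <;> simp [Matrix.mul_apply, Fin.sum_univ_succ] <;> ring⟩)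
    (fun x₁ x₂ x₃ x₄ =>
      ⟨-x₁, -x₂, -x₃, -x₄
          + x₁ * (D 0 0 * x₁ + D 0 1 * x₂ + D 0 2 * x₃)
          + x₂ * (D 1 0 * x₁ + D 1 1 * x₂ + D 1 2 * x₃)
          + x₃ * (D 2 0 * x₁ + D 2 1 * x₂ + D 2 2 * x₃), by
        ext i j
        fin_cases i <;> fin_cases j <;> simp [Matrix.mul_apply, Fin.sum_univ_succ] <;> ring⟩)

/-- The translation subgroup `Tr_4` of `AGL_4(F)`. -/
def subgroupTr4 (F : Type*) [Field F] : Subgroup (AGL 4 F) :=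
  paramSubgroup (fun x₁ x₂ x₃ x₄ =>
      !![1, x₁, x₂, x₃, x₄;
         0, 1, 0, 0, 0;
         0, 0, 1, 0, 0;
         0, 0, 0, 1, 0;
         0, 0, 0, 0, 1])
    ⟨0, 0, 0, 0, by ext i j; fin_cases i <;> fin_cases j <;> rfl⟩
    (fun x₁ x₂ x₃ x₄ y₁ y₂ y₃ y₄ =>
      ⟨x₁ + y₁, x₂ + y₂, x₃ + y₃, x₄ + y₄, by
        ext i j
        fin_cases i <;> fin_cases j <;> simp [Matrix.mul_apply, Fin.sum_univ_succ] <;> ring⟩)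
    (fun x₁ x₂ x₃ x₄ =>
      ⟨-x₁, -x₂, -x₃, -x₄, by
        ext i j
        fin_cases i <;> fin_cases j <;> simp [Matrix.mul_apply, Fin.sum_univ_succ]⟩)

/-- The elementary `3 × 3` matrix with `1` at position `(i, j)` (indices from `0`) and `0`
elsewhere. -/
abbrev elemMatrix3 (F : Type*) [Field F] (i j : Fin 3) : Matrix (Fin 3) (Fin 3) F :=
  Matrix.single i j 1

/-! Classifying abelian regular subgroups amounts to classifying commutative nilpotent associative
algebras of dimension 4. If R is abelian and regular, let γ_w be its element that moves 0 to w, and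
write γ_w(v) = v + w + m(v, w). Commutativity of R makes m symmetric; m is linear in v because γ_w
is affine, hence bilinear. Closure of R under products makes m associative. Injectivity of each γ_w
excludes nonzero eigenvalues of the operators m(y, ·), so over an algebraically closed field they
are nilpotent (`IsAbelianRegular.exists_inducesSubgroup`).

Conjugate subgroups correspond to isomorphic algebras. A linear isomorphism is itself a conjugating
element (`MulIso.isConjSubgroup`). Conversely, a conjugating element can be corrected by an element
of R until it fixes 0, and it is then linear (`IsConjSubgroup.mulIso`).

For the algebras, an Engel argument gives a basis in which multiplication is strictly triangular, so
ten structure constants remain, subject to six equations from associativity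
(`hasNormalForm_of_isNilpotent`). Changes of basis reduce these to a short list
(`hasNormalForm_triMul`). The cases are: all products in one line, which is the theory of symmetric
bilinear forms in three variables; two generators with zero triple products, which is a pencil of
binary forms; and algebras in which a vector can be completed by its square to part of a triangular
basis. A numerical invariant tells the normal forms apart (`mulInvariant`).

The characteristic enters twice. A nonzero alternating symmetric form exists only if 2 = 0, which
gives the tenth class. The algebra of U₁(1, 0) is isomorphic to that of U₁(0, 1) when 2 ≠ 0, which
accounts for the different representatives. -/

/-! ### Isomorphisms of multiplications on `F ^ 4` -/

/-- Two multiplications on `F ^ 4` are isomorphic by an invertible linear map. -/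
def MulIso {F : Type*} [Field F] (m m' : (Fin 4 → F) → (Fin 4 → F) → (Fin 4 → F)) : Prop :=
  ∃ φ : (Fin 4 → F) ≃ₗ[F] (Fin 4 → F), ∀ x y, φ (m x y) = m' (φ x) (φ y)

namespace MulIso

variable {F : Type*} [Field F] {m m' m'' : (Fin 4 → F) → (Fin 4 → F) → (Fin 4 → F)}

theorem refl (m : (Fin 4 → F) → (Fin 4 → F) → (Fin 4 → F)) : MulIso m m :=
  ⟨LinearEquiv.refl F _, fun _ _ => rfl⟩

theorem symm (h : MulIso m m') : MulIso m' m := by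
  obtain ⟨φ, hφ⟩ := h
  refine ⟨φ.symm, fun x y => ?_⟩
  rw [LinearEquiv.symm_apply_eq, hφ]
  simp

theorem trans (h : MulIso m m') (h' : MulIso m' m'') : MulIso m m'' := by
  obtain ⟨φ, hφ⟩ := h
  obtain ⟨ψ, hψ⟩ := h'
  exact ⟨φ.trans ψ, fun x y => by simp [hφ, hψ]⟩

/-- An invertible matrix `P`, whose rows are the new basis vectors, gives an isomorphism. -/
theorem of_matrix (P Q : Matrix (Fin 4) (Fin 4) F) (hPQ : P * Q = 1)
    (h : ∀ x y, Matrix.vecMul (m x y) P = m' (Matrix.vecMul x P) (Matrix.vecMul y P)) :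
    MulIso m m' := by
  have hQP : Q * P = 1 := mul_eq_one_comm.mp hPQ
  refine ⟨LinearEquiv.ofLinearMap (Matrix.vecMulLinear P) (Matrix.vecMulLinear Q)
    (LinearMap.ext fun x => ?_) (LinearMap.ext fun x => ?_), ?_⟩
  · simp [Matrix.vecMul_vecMul, hQP]
  · simp [Matrix.vecMul_vecMul, hPQ]
  · intro x y
    exact h x y

end MulIso

/-! ### Strictly triangular multiplications and the list of normal forms -/

/-- The commutative multiplication on `F ^ 4` given by
`e₁² = a e₂ + b e₃ + c e₄`, `e₁ e₂ = d e₃ + e e₄`, `e₁ e₃ = k e₄`, `e₂² = p e₃ + q e₄`,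
`e₂ e₃ = r e₄`, `e₃² = s e₄`, and `e₄ x = 0`. -/
def triMul {F : Type*} [Field F] (a b c d e k p q r s : F) (x y : Fin 4 → F) : Fin 4 → F :=
  ![0,
    a * (x 0 * y 0),
    b * (x 0 * y 0) + d * (x 0 * y 1 + x 1 * y 0) + p * (x 1 * y 1),
    c * (x 0 * y 0) + e * (x 0 * y 1 + x 1 * y 0) + k * (x 0 * y 2 + x 2 * y 0)
      + q * (x 1 * y 1) + r * (x 1 * y 2 + x 2 * y 1) + s * (x 2 * y 2)]

/-- A multiplication on `F ^ 4` that is isomorphic to one on the list of normal forms. -/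
def HasNormalForm {F : Type*} [Field F] (m : (Fin 4 → F) → (Fin 4 → F) → (Fin 4 → F)) : Prop :=
  MulIso m (triMul 1 0 0 1 0 1 0 1 0 0) ∨ MulIso m (triMul 1 0 0 1 0 0 0 0 0 0) ∨
  MulIso m (triMul 1 0 0 0 1 0 0 0 0 1) ∨ MulIso m (triMul 0 1 0 0 1 0 0 0 0 0) ∨
  MulIso m (triMul 0 1 0 0 1 0 0 1 0 0) ∨ MulIso m (triMul 0 0 1 0 0 0 0 0 0 0) ∨
  MulIso m (triMul 0 0 1 0 0 0 0 1 0 0) ∨ MulIso m (triMul 0 0 1 0 0 0 0 1 0 1) ∨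
  MulIso m (triMul 0 0 0 0 0 0 0 0 0 0) ∨
  ((2 : F) = 0 ∧ MulIso m (triMul 0 0 0 0 0 0 0 0 1 0))

theorem MulIso.hasNormalForm {F : Type*} [Field F]
    {m m' : (Fin 4 → F) → (Fin 4 → F) → (Fin 4 → F)} (h : MulIso m' m)
    (h' : HasNormalForm m') : HasNormalForm m := by
  have hs := h.symm
  rcases h' with h | h | h | h | h | h | h | h | h | ⟨h2, h⟩
  · exact Or.inl (hs.trans h)
  · exact Or.inr (Or.inl (hs.trans h))
  · exact Or.inr (Or.inr (Or.inl (hs.trans h)))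
  · exact Or.inr (Or.inr (Or.inr (Or.inl (hs.trans h))))
  · exact Or.inr (Or.inr (Or.inr (Or.inr (Or.inl (hs.trans h)))))
  · exact Or.inr (Or.inr (Or.inr (Or.inr (Or.inr (Or.inl (hs.trans h))))))
  · exact Or.inr (Or.inr (Or.inr (Or.inr (Or.inr (Or.inr (Or.inl (hs.trans h)))))))
  · exact Or.inr (Or.inr (Or.inr (Or.inr (Or.inr (Or.inr (Or.inr (Or.inl (hs.trans h))))))))
  · exact Or.inr (Or.inr (Or.inr (Or.inr (Or.inr (Or.inr (Or.inr (Or.inr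
      (Or.inl (hs.trans h)))))))))
  · exact Or.inr (Or.inr (Or.inr (Or.inr (Or.inr (Or.inr (Or.inr (Or.inr
      (Or.inr ⟨h2, hs.trans h⟩))))))))

/-- A change of basis between two multiplications `triMul`, with the comparison of products
reduced to the products of the new basis vectors. -/
theorem MulIso.triMul_of_matrix {F : Type*} [Field F] {a b c d e k p q r s : F}
    {a' b' c' d' e' k' p' q' r' s' : F} (P Q : Matrix (Fin 4) (Fin 4) F) (hPQ : P * Q = 1)
    (h00 : triMul a b c d e k p q r s (P 0) (P 0) = a' • P 1 + b' • P 2 + c' • P 3)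
    (h01 : triMul a b c d e k p q r s (P 0) (P 1) = d' • P 2 + e' • P 3)
    (h02 : triMul a b c d e k p q r s (P 0) (P 2) = k' • P 3)
    (h11 : triMul a b c d e k p q r s (P 1) (P 1) = p' • P 2 + q' • P 3)
    (h12 : triMul a b c d e k p q r s (P 1) (P 2) = r' • P 3)
    (h22 : triMul a b c d e k p q r s (P 2) (P 2) = s' • P 3)
    (h3 : ∀ i, triMul a b c d e k p q r s (P i) (P 3) = 0) :
    MulIso (triMul a' b' c' d' e' k' p' q' r' s') (triMul a b c d e k p q r s) := by
  refine MulIso.of_matrix P Q hPQ fun x y => ?_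
  have h30 := h3 0
  have h31 := h3 1
  have h32 := h3 2
  have h33 := h3 3
  ext j
  have g00 := congrFun h00 j
  have g01 := congrFun h01 j
  have g02 := congrFun h02 j
  have g11 := congrFun h11 j
  have g12 := congrFun h12 j
  have g22 := congrFun h22 j
  have g30 := congrFun h30 j
  have g31 := congrFun h31 j
  have g32 := congrFun h32 j
  have g33 := congrFun h33 j
  have expand : triMul a b c d e k p q r s (Matrix.vecMul x P) (Matrix.vecMul y P) j =
      (x 0 * y 0) * triMul a b c d e k p q r s (P 0) (P 0) j
      + (x 0 * y 1 + x 1 * y 0) * triMul a b c d e k p q r s (P 0) (P 1) j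
      + (x 0 * y 2 + x 2 * y 0) * triMul a b c d e k p q r s (P 0) (P 2) j
      + (x 1 * y 1) * triMul a b c d e k p q r s (P 1) (P 1) j
      + (x 1 * y 2 + x 2 * y 1) * triMul a b c d e k p q r s (P 1) (P 2) j
      + (x 2 * y 2) * triMul a b c d e k p q r s (P 2) (P 2) j
      + (x 0 * y 3 + x 3 * y 0) * triMul a b c d e k p q r s (P 0) (P 3) j
      + (x 1 * y 3 + x 3 * y 1) * triMul a b c d e k p q r s (P 1) (P 3) j
      + (x 2 * y 3 + x 3 * y 2) * triMul a b c d e k p q r s (P 2) (P 3) j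
      + (x 3 * y 3) * triMul a b c d e k p q r s (P 3) (P 3) j := by
    clear g00 g01 g02 g11 g12 g22 g30 g31 g32 g33
    fin_cases j <;>
      simp only [triMul, Matrix.vecMul, dotProduct, Fin.sum_univ_four] <;>
      simp <;> ring
  rw [expand, g00, g01, g02, g11, g12, g22, g30, g31, g32, g33]
  simp only [triMul, Matrix.vecMul, dotProduct, Fin.sum_univ_four]
  simp
  ring

/-! ### All products in the line of e₄: symmetric bilinear forms in three variables -/

section NormalForms

variable {F : Type*} [Field F]

theorem hasNormalForm_form_swap₂₃ {c e k q r s : F}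
    (h : HasNormalForm (triMul 0 0 c 0 k e 0 s r q)) :
    HasNormalForm (triMul 0 0 c 0 e k 0 q r s) := by
  refine MulIso.hasNormalForm (MulIso.triMul_of_matrix
    !![1, 0, 0, 0; 0, 0, 1, 0; 0, 1, 0, 0; 0, 0, 0, 1]
    !![1, 0, 0, 0; 0, 0, 1, 0; 0, 1, 0, 0; 0, 0, 0, 1] ?_ ?_ ?_ ?_ ?_ ?_ ?_ ?_) h
  · ext i j
    fin_cases i <;> fin_cases j <;> simp [Matrix.mul_apply, Fin.sum_univ_four]
  on_goal 7 => intro i; fin_cases i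
  all_goals
    ext j
    fin_cases j <;> simp [triMul]

theorem hasNormalForm_form_swap₁₂ {c e k q r s : F}
    (h : HasNormalForm (triMul 0 0 q 0 e r 0 c k s)) :
    HasNormalForm (triMul 0 0 c 0 e k 0 q r s) := by
  refine MulIso.hasNormalForm (MulIso.triMul_of_matrix
    !![0, 1, 0, 0; 1, 0, 0, 0; 0, 0, 1, 0; 0, 0, 0, 1]
    !![0, 1, 0, 0; 1, 0, 0, 0; 0, 0, 1, 0; 0, 0, 0, 1] ?_ ?_ ?_ ?_ ?_ ?_ ?_ ?_) h
  · ext i j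
    fin_cases i <;> fin_cases j <;> simp [Matrix.mul_apply, Fin.sum_univ_four]
  on_goal 7 => intro i; fin_cases i
  all_goals
    ext j
    fin_cases j <;> simp [triMul]

/-- One step of Gram–Schmidt: e₁ is divided by a square root of c, and its projections are
subtracted from e₂ and e₃. No division by 2 occurs, so the step works in every characteristic. -/
theorem hasNormalForm_form_clear₁ [IsAlgClosed F] {c e k q r s : F} (hc : c ≠ 0)
    (h : HasNormalForm (triMul 0 0 1 0 0 0 0 (q - e ^ 2 / c) (r - e * k / c) (s - k ^ 2 / c))) :
    HasNormalForm (triMul 0 0 c 0 e k 0 q r s) := by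
  obtain ⟨γ, rfl⟩ := IsAlgClosed.exists_eq_mul_self c
  have hγ : γ ≠ 0 := by rintro rfl; simp at hc
  refine MulIso.hasNormalForm (MulIso.triMul_of_matrix
    !![γ⁻¹, 0, 0, 0; -e / (γ * γ), 1, 0, 0; -k / (γ * γ), 0, 1, 0; 0, 0, 0, 1]
    !![γ, 0, 0, 0; e / γ, 1, 0, 0; k / γ, 0, 1, 0; 0, 0, 0, 1] ?_ ?_ ?_ ?_ ?_ ?_ ?_ ?_) h
  · ext i j
    fin_cases i <;> fin_cases j <;>
      simp [Matrix.mul_apply, Fin.sum_univ_four] <;> field_simp <;> ring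
  on_goal 7 => intro i; fin_cases i
  all_goals
    ext j
    fin_cases j <;> simp [triMul] <;> field_simp <;> ring

theorem hasNormalForm_form_clear₂ [IsAlgClosed F] {q r s : F} (hq : q ≠ 0)
    (h : HasNormalForm (triMul 0 0 1 0 0 0 0 1 0 (s - r ^ 2 / q))) :
    HasNormalForm (triMul 0 0 1 0 0 0 0 q r s) := by
  obtain ⟨γ, rfl⟩ := IsAlgClosed.exists_eq_mul_self q
  have hγ : γ ≠ 0 := by rintro rfl; simp at hq
  refine MulIso.hasNormalForm (MulIso.triMul_of_matrix
    !![1, 0, 0, 0; 0, γ⁻¹, 0, 0; 0, -r / (γ * γ), 1, 0; 0, 0, 0, 1]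
    !![1, 0, 0, 0; 0, γ, 0, 0; 0, r / γ, 1, 0; 0, 0, 0, 1] ?_ ?_ ?_ ?_ ?_ ?_ ?_ ?_) h
  · ext i j
    fin_cases i <;> fin_cases j <;>
      simp [Matrix.mul_apply, Fin.sum_univ_four] <;> field_simp <;> ring
  on_goal 7 => intro i; fin_cases i
  all_goals
    ext j
    fin_cases j <;> simp [triMul] <;> field_simp <;> ring

theorem hasNormalForm_form_diagonal [IsAlgClosed F] (s : F) :
    HasNormalForm (triMul 0 0 1 0 0 0 0 1 0 s) := by
  by_cases hs : s = 0
  · subst hs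
    exact Or.inr (Or.inr (Or.inr (Or.inr (Or.inr (Or.inr (Or.inl (MulIso.refl _)))))))
  have h : HasNormalForm (triMul (0 : F) 0 1 0 0 0 0 1 0 1) :=
    Or.inr (Or.inr (Or.inr (Or.inr (Or.inr (Or.inr (Or.inr (Or.inl (MulIso.refl _))))))))
  obtain ⟨γ, rfl⟩ := IsAlgClosed.exists_eq_mul_self s
  have hγ : γ ≠ 0 := by rintro rfl; simp at hs
  refine MulIso.hasNormalForm (MulIso.triMul_of_matrix
    !![1, 0, 0, 0; 0, 1, 0, 0; 0, 0, γ⁻¹, 0; 0, 0, 0, 1]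
    !![1, 0, 0, 0; 0, 1, 0, 0; 0, 0, γ, 0; 0, 0, 0, 1] ?_ ?_ ?_ ?_ ?_ ?_ ?_ ?_) h
  · ext i j
    fin_cases i <;> fin_cases j <;>
      simp [Matrix.mul_apply, Fin.sum_univ_four] <;> field_simp
  on_goal 7 => intro i; fin_cases i
  all_goals
    ext j
    fin_cases j <;> simp [triMul] <;> field_simp

/-- A hyperbolic plane cannot be diagonalized by itself in characteristic 2, but its sum with a
nonisotropic line can. With ι² = -1, the rows (1, 1/r, 0), (1, 0, -1) and ι(1, 1/r, -1) are
orthonormal in every characteristic. -/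
theorem hasNormalForm_form_one_hyperbolic [IsAlgClosed F] {r : F} (hr : r ≠ 0) :
    HasNormalForm (triMul 0 0 1 0 0 0 0 0 r 0) := by
  have h : HasNormalForm (triMul (0 : F) 0 1 0 0 0 0 1 0 1) :=
    Or.inr (Or.inr (Or.inr (Or.inr (Or.inr (Or.inr (Or.inr (Or.inl (MulIso.refl _))))))))
  obtain ⟨ι, hι⟩ := IsAlgClosed.exists_eq_mul_self (-1 : F)
  refine MulIso.hasNormalForm (MulIso.triMul_of_matrix
    !![1, r⁻¹, 0, 0; 1, 0, -1, 0; ι, ι / r, -ι, 0; 0, 0, 0, 1]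
    !![1, 1, ι, 0; 0, -r, -(r * ι), 0; 1, 0, ι, 0; 0, 0, 0, 1] ?_ ?_ ?_ ?_ ?_ ?_ ?_ ?_) h
  · ext i j
    fin_cases i <;> fin_cases j <;>
      simp [Matrix.mul_apply, Fin.sum_univ_four] <;> field_simp <;>
        first | ring1 | linear_combination hι
  on_goal 7 => intro i; fin_cases i
  all_goals
    ext j
    fin_cases j <;> simp [triMul] <;> field_simp <;> first | ring1 | linear_combination hι

theorem hasNormalForm_form_of_ne_zero [IsAlgClosed F] {c e k q r s : F} (hc : c ≠ 0) :
    HasNormalForm (triMul 0 0 c 0 e k 0 q r s) := by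
  refine hasNormalForm_form_clear₁ hc ?_
  generalize q - e ^ 2 / c = q'
  generalize r - e * k / c = r'
  generalize s - k ^ 2 / c = s'
  by_cases hq : q' = 0
  · by_cases hs : s' = 0
    · subst hq hs
      by_cases hr : r' = 0
      · subst hr
        exact Or.inr (Or.inr (Or.inr (Or.inr (Or.inr (Or.inl (MulIso.refl _))))))
      · exact hasNormalForm_form_one_hyperbolic hr
    · exact hasNormalForm_form_swap₂₃ (hasNormalForm_form_clear₂ hs
        (hasNormalForm_form_diagonal _))
  · exact hasNormalForm_form_clear₂ hq (hasNormalForm_form_diagonal _)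

/-- If the diagonal of the form vanishes, (e₁ + e₂)² = 2 e₁e₂, which is nonzero once 2 and e₁e₂ are.
-/
theorem hasNormalForm_form_add₁₂ {e k r : F}
    (h : HasNormalForm (triMul 0 0 (2 * e) 0 e (k + r) 0 0 r 0)) :
    HasNormalForm (triMul 0 0 0 0 e k 0 0 r 0) := by
  refine MulIso.hasNormalForm (MulIso.triMul_of_matrix
    !![1, 1, 0, 0; 0, 1, 0, 0; 0, 0, 1, 0; 0, 0, 0, 1]
    !![1, -1, 0, 0; 0, 1, 0, 0; 0, 0, 1, 0; 0, 0, 0, 1] ?_ ?_ ?_ ?_ ?_ ?_ ?_ ?_) h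
  · ext i j
    fin_cases i <;> fin_cases j <;>
      simp [Matrix.mul_apply, Fin.sum_univ_four]
  on_goal 7 => intro i; fin_cases i
  all_goals
    ext j
    fin_cases j <;> simp [triMul] <;> ring

theorem hasNormalForm_form_alternating (h2 : (2 : F) = 0) {e k r : F} (hr : r ≠ 0) :
    HasNormalForm (triMul 0 0 0 0 e k 0 0 r 0) := by
  have h : HasNormalForm (triMul (0 : F) 0 0 0 0 0 0 0 1 0) :=
    Or.inr (Or.inr (Or.inr (Or.inr (Or.inr (Or.inr (Or.inr (Or.inr
      (Or.inr ⟨h2, MulIso.refl _⟩))))))))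
  -- The first row spans the radical of the form on the span of e₁, e₂, e₃; its square is a multiple
  -- of 2, hence zero.
  refine MulIso.hasNormalForm (MulIso.triMul_of_matrix
    !![1, -k / r, -e / r, 0; 0, r⁻¹, 0, 0; 0, 0, 1, 0; 0, 0, 0, 1]
    !![1, k, e / r, 0; 0, r, 0, 0; 0, 0, 1, 0; 0, 0, 0, 1] ?_ ?_ ?_ ?_ ?_ ?_ ?_ ?_) h
  · ext i j
    fin_cases i <;> fin_cases j <;>
      simp [Matrix.mul_apply, Fin.sum_univ_four] <;> field_simp <;> ring
  on_goal 7 => intro i; fin_cases i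
  all_goals
    ext j
    fin_cases j <;> simp [triMul] <;> field_simp <;>
      first | ring1 | linear_combination (e * k) * h2 | linear_combination (-e * k) * h2

theorem hasNormalForm_form [IsAlgClosed F] (c e k q r s : F) :
    HasNormalForm (triMul 0 0 c 0 e k 0 q r s) := by
  by_cases hc : c = 0
  swap
  · exact hasNormalForm_form_of_ne_zero hc
  by_cases hq : q = 0
  swap
  · exact hasNormalForm_form_swap₁₂ (hasNormalForm_form_of_ne_zero hq)
  by_cases hs : s = 0
  swap
  · exact hasNormalForm_form_swap₂₃ (hasNormalForm_form_swap₁₂ (hasNormalForm_form_of_ne_zero hs))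
  subst hc hq hs
  have main : ∀ {e k r : F}, r ≠ 0 → HasNormalForm (triMul 0 0 0 0 e k 0 0 r 0) := by
    intro e k r hr
    by_cases h2 : (2 : F) = 0
    · exact hasNormalForm_form_alternating h2 hr
    -- The three swaps exchange e₁ with e₃, so that r becomes the product of the first two basis
    -- vectors.
    · exact hasNormalForm_form_swap₂₃ (hasNormalForm_form_swap₁₂ (hasNormalForm_form_swap₂₃
        (hasNormalForm_form_add₁₂ (hasNormalForm_form_of_ne_zero (mul_ne_zero h2 hr)))))
  by_cases hr : r = 0
  swap
  · exact main hr
  by_cases hk : k = 0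
  swap
  · exact hasNormalForm_form_swap₁₂ (main hk)
  by_cases he : e = 0
  swap
  · exact hasNormalForm_form_swap₂₃ (hasNormalForm_form_swap₁₂ (main he))
  subst hr hk he
  exact Or.inr (Or.inr (Or.inr (Or.inr (Or.inr (Or.inr (Or.inr (Or.inr
    (Or.inl (MulIso.refl _)))))))))

/-! ### Two generators with zero triple products: pencils of binary forms -/

theorem hasNormalForm_pencil_swap₁₂ {b c d e p q : F}
    (h : HasNormalForm (triMul 0 p q d e 0 b c 0 0)) :
    HasNormalForm (triMul 0 b c d e 0 p q 0 0) := by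
  refine MulIso.hasNormalForm (MulIso.triMul_of_matrix
    !![0, 1, 0, 0; 1, 0, 0, 0; 0, 0, 1, 0; 0, 0, 0, 1]
    !![0, 1, 0, 0; 1, 0, 0, 0; 0, 0, 1, 0; 0, 0, 0, 1] ?_ ?_ ?_ ?_ ?_ ?_ ?_ ?_) h
  · ext i j
    fin_cases i <;> fin_cases j <;>
      simp [Matrix.mul_apply, Fin.sum_univ_four]
  on_goal 7 => intro i; fin_cases i
  all_goals
    ext j
    fin_cases j <;> simp [triMul]

theorem hasNormalForm_pencil_zero (u : F) :
    HasNormalForm (triMul 0 1 0 0 1 0 0 u 0 0) := by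
  by_cases hu : u = 0
  · subst hu
    exact Or.inr (Or.inr (Or.inr (Or.inl (MulIso.refl _))))
  have h : HasNormalForm (triMul (0 : F) 1 0 0 1 0 0 1 0 0) :=
    Or.inr (Or.inr (Or.inr (Or.inr (Or.inl (MulIso.refl _)))))
  refine MulIso.hasNormalForm (MulIso.triMul_of_matrix
    !![1, 0, 0, 0; 0, u⁻¹, 0, 0; 0, 0, 1, 0; 0, 0, 0, u⁻¹]
    !![1, 0, 0, 0; 0, u, 0, 0; 0, 0, 1, 0; 0, 0, 0, u] ?_ ?_ ?_ ?_ ?_ ?_ ?_ ?_) h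
  · ext i j
    fin_cases i <;> fin_cases j <;>
      simp [Matrix.mul_apply, Fin.sum_univ_four] <;> field_simp
  on_goal 7 => intro i; fin_cases i
  all_goals
    ext j
    fin_cases j <;> simp [triMul] <;> field_simp

theorem hasNormalForm_pencil_quadratic [IsAlgClosed F] (s t : F) :
    HasNormalForm (triMul 0 1 0 0 1 0 s t 0 0) := by
  obtain ⟨κ, hκ⟩ : ∃ κ : F, κ ^ 2 = t * κ + s := by
    have hdeg : (Polynomial.X ^ 2 - (Polynomial.C t * Polynomial.X + Polynomial.C s)).degree
        ≠ 0 := by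
      rw [Polynomial.degree_sub_eq_left_of_degree_lt]
      · simp
      · refine lt_of_le_of_lt Polynomial.degree_linear_le ?_
        simp
    obtain ⟨κ, h⟩ := IsAlgClosed.exists_root _ hdeg
    refine ⟨κ, ?_⟩
    simpa [sub_eq_zero] using h
  -- Put f = e₂ - κe₁ and e₄' = e₁f = e₄ - κe₃. The quadratic equation for κ says exactly that f² =
  -- (t - 2κ) e₄'.
  have h := hasNormalForm_pencil_zero (t - 2 * κ)
  refine MulIso.hasNormalForm (MulIso.triMul_of_matrix
    !![1, 0, 0, 0; -κ, 1, 0, 0; 0, 0, 1, 0; 0, 0, -κ, 1]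
    !![1, 0, 0, 0; κ, 1, 0, 0; 0, 0, 1, 0; 0, 0, κ, 1] ?_ ?_ ?_ ?_ ?_ ?_ ?_ ?_) h
  · ext i j
    fin_cases i <;> fin_cases j <;>
      simp [Matrix.mul_apply, Fin.sum_univ_four]
  on_goal 7 => intro i; fin_cases i
  all_goals
    ext j
    fin_cases j <;> simp [triMul] <;> first | ring1 | linear_combination hκ | linear_combination -hκ

/-- The hypothesis makes e₁² and e₁e₂ independent, so they can serve as the new e₃ and e₄; Cramer's
rule gives the coordinates of e₂². -/
theorem hasNormalForm_pencil_of_ne [IsAlgClosed F] {b c d e p q : F} (h0 : b * e - c * d ≠ 0) :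
    HasNormalForm (triMul 0 b c d e 0 p q 0 0) := by
  have h := hasNormalForm_pencil_quadratic ((p * e - q * d) / (b * e - c * d))
    ((b * q - c * p) / (b * e - c * d))
  generalize hδ : b * e - c * d = δ at h h0
  refine MulIso.hasNormalForm (MulIso.triMul_of_matrix
    !![1, 0, 0, 0; 0, 1, 0, 0; 0, 0, b, c; 0, 0, d, e]
    !![1, 0, 0, 0; 0, 1, 0, 0; 0, 0, e / δ, -c / δ; 0, 0, -d / δ, b / δ] ?_ ?_ ?_ ?_ ?_ ?_ ?_ ?_) h
  · ext i j
    fin_cases i <;> fin_cases j <;>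
      simp [Matrix.mul_apply, Fin.sum_univ_four] <;> grind
  on_goal 7 => intro i; fin_cases i
  all_goals
    ext j
    fin_cases j <;> simp [triMul] <;> grind

theorem hasNormalForm_pencil_add₁₂ {b c p q d e : F}
    (h : HasNormalForm (triMul 0 b c (b + d) (c + e) 0 (b + 2 * d + p) (c + 2 * e + q) 0 0)) :
    HasNormalForm (triMul 0 b c d e 0 p q 0 0) := by
  refine MulIso.hasNormalForm (MulIso.triMul_of_matrix
    !![1, 0, 0, 0; 1, 1, 0, 0; 0, 0, 1, 0; 0, 0, 0, 1]
    !![1, 0, 0, 0; -1, 1, 0, 0; 0, 0, 1, 0; 0, 0, 0, 1] ?_ ?_ ?_ ?_ ?_ ?_ ?_ ?_) h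
  · ext i j
    fin_cases i <;> fin_cases j <;>
      simp [Matrix.mul_apply, Fin.sum_univ_four]
  on_goal 7 => intro i; fin_cases i
  all_goals
    ext j
    fin_cases j <;> simp [triMul] <;> ring

theorem hasNormalForm_pencil_rank_one [IsAlgClosed F] {x y z u v : F} (hu : u ≠ 0) :
    HasNormalForm (triMul 0 (x * u) (x * v) (y * u) (y * v) 0 (z * u) (z * v) 0 0) := by
  have h := hasNormalForm_form x y 0 z 0 0
  refine MulIso.hasNormalForm (MulIso.triMul_of_matrix
    !![1, 0, 0, 0; 0, 1, 0, 0; 0, 0, 0, 1; 0, 0, u, v]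
    !![1, 0, 0, 0; 0, 1, 0, 0; 0, 0, -v / u, u⁻¹; 0, 0, 1, 0] ?_ ?_ ?_ ?_ ?_ ?_ ?_ ?_) h
  · ext i j
    fin_cases i <;> fin_cases j <;>
      simp [Matrix.mul_apply, Fin.sum_univ_four] <;> field_simp <;> ring
  on_goal 7 => intro i; fin_cases i
  all_goals
    ext j
    fin_cases j <;> simp [triMul]

/-- Commutative algebras generated by two elements with all triple products equal to zero. -/
theorem hasNormalForm_pencil [IsAlgClosed F] (b c d e p q : F) :
    HasNormalForm (triMul 0 b c d e 0 p q 0 0) := by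
  by_cases h1 : b * e - c * d = 0
  swap
  · exact hasNormalForm_pencil_of_ne h1
  by_cases h2 : p * e - q * d = 0
  swap
  · exact hasNormalForm_pencil_swap₁₂ (hasNormalForm_pencil_of_ne h2)
  by_cases h3 : b * q - c * p = 0
  swap
  -- Here e₁² and e₂² are independent while e₁e₂ is proportional to each. Then (e₁ + e₂)² and e₁(e₁
  -- + e₂) are independent.
  · refine hasNormalForm_pencil_add₁₂ (hasNormalForm_pencil_swap₁₂
      (hasNormalForm_pencil_of_ne fun h => h3 ?_))
    linear_combination -h - h1 + h2
  -- From here all three products lie in one line. A nonzero product becomes the new e₄, which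
  -- reduces to a bilinear form.
  by_cases hb : b = 0
  swap
  · have h := hasNormalForm_pencil_rank_one (x := 1) (y := d / b) (z := p / b) (v := c) hb
    convert h using 2 <;> field_simp
    · linear_combination h1
    · linear_combination h3
  by_cases hd : d = 0
  swap
  · have h := hasNormalForm_pencil_rank_one (x := b / d) (y := 1) (z := p / d) (v := e) hd
    convert h using 2 <;> field_simp
    · linear_combination -h1
    · linear_combination -h2
  by_cases hp : p = 0
  swap
  · have h := hasNormalForm_pencil_rank_one (x := b / p) (y := d / p) (z := 1) (v := q) hp
    convert h using 2 <;> field_simp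
    · linear_combination -h3
    · linear_combination h2
  subst hb hd hp
  exact hasNormalForm_form _ _ _ _ _ _

/-! ### Algebras in which e₁² can be taken as the second basis vector -/

theorem hasNormalForm_monogenic (κ : F) : HasNormalForm (triMul 1 0 0 1 0 κ 0 κ 0 0) := by
  by_cases hκ : κ = 0
  · subst hκ
    exact Or.inr (Or.inl (MulIso.refl _))
  have h : HasNormalForm (triMul (1 : F) 0 0 1 0 1 0 1 0 0) := Or.inl (MulIso.refl _)
  refine MulIso.hasNormalForm (MulIso.triMul_of_matrix
    !![1, 0, 0, 0; 0, 1, 0, 0; 0, 0, 1, 0; 0, 0, 0, κ]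
    !![1, 0, 0, 0; 0, 1, 0, 0; 0, 0, 1, 0; 0, 0, 0, κ⁻¹] ?_ ?_ ?_ ?_ ?_ ?_ ?_ ?_) h
  · ext i j
    fin_cases i <;> fin_cases j <;>
      simp [Matrix.mul_apply, Fin.sum_univ_four] <;> field_simp
  on_goal 7 => intro i; fin_cases i
  all_goals
    ext j
    fin_cases j <;> simp [triMul]

/-- Since d ≠ 0, the vector e₁³ = de₃ + ee₄ can replace e₃. Then e₁⁴ = dk e₄, so all products are
among powers of e₁. -/
theorem hasNormalForm_cube_ne_zero {d e k : F} (hd : d ≠ 0) :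
    HasNormalForm (triMul 1 0 0 d e k 0 (d * k) 0 0) := by
  have h := hasNormalForm_monogenic (d * k)
  refine MulIso.hasNormalForm (MulIso.triMul_of_matrix
    !![1, 0, 0, 0; 0, 1, 0, 0; 0, 0, d, e; 0, 0, 0, 1]
    !![1, 0, 0, 0; 0, 1, 0, 0; 0, 0, d⁻¹, -e / d; 0, 0, 0, 1] ?_ ?_ ?_ ?_ ?_ ?_ ?_ ?_) h
  · ext i j
    fin_cases i <;> fin_cases j <;>
      simp [Matrix.mul_apply, Fin.sum_univ_four] <;> field_simp <;> ring
  on_goal 7 => intro i; fin_cases i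
  all_goals
    ext j
    fin_cases j <;> simp [triMul] <;> ring

/-- The vector e₃ - ke₂ annihilates the algebra and splits off from the span of e₁, e₁², e₁³. -/
theorem hasNormalForm_cube_one_split (k : F) :
    HasNormalForm (triMul 1 0 0 0 1 k 0 0 0 0) := by
  have h : HasNormalForm (triMul (1 : F) 0 0 1 0 0 0 0 0 0) := Or.inr (Or.inl (MulIso.refl _))
  refine MulIso.hasNormalForm (MulIso.triMul_of_matrix
    !![1, 0, 0, 0; 0, 1, 0, 0; 0, 0, 0, 1; 0, -k, 1, 0]
    !![1, 0, 0, 0; 0, 1, 0, 0; 0, k, 0, 1; 0, 0, 1, 0] ?_ ?_ ?_ ?_ ?_ ?_ ?_ ?_) h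
  · ext i j
    fin_cases i <;> fin_cases j <;>
      simp [Matrix.mul_apply, Fin.sum_univ_four]
  on_goal 7 => intro i; fin_cases i
  all_goals
    ext j
    fin_cases j <;> simp [triMul]

theorem hasNormalForm_cube_one [IsAlgClosed F] (k s : F) :
    HasNormalForm (triMul 1 0 0 0 1 k 0 0 0 s) := by
  by_cases hs : s = 0
  · subst hs
    exact hasNormalForm_cube_one_split k
  obtain ⟨γ, rfl⟩ := IsAlgClosed.exists_eq_mul_self s
  have hγ : γ ≠ 0 := by rintro rfl; simp at hs
  have h : HasNormalForm (triMul (1 : F) 0 0 0 1 0 0 0 0 1) :=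
    Or.inr (Or.inr (Or.inl (MulIso.refl _)))
  refine MulIso.hasNormalForm (MulIso.triMul_of_matrix
    !![1, 0, 0, 0; 0, 1, 0, 0; 0, -k / γ, γ⁻¹, 0; 0, 0, 0, 1]
    !![1, 0, 0, 0; 0, 1, 0, 0; 0, k, γ, 0; 0, 0, 0, 1] ?_ ?_ ?_ ?_ ?_ ?_ ?_ ?_) h
  · ext i j
    fin_cases i <;> fin_cases j <;>
      simp [Matrix.mul_apply, Fin.sum_univ_four] <;> field_simp <;> ring
  on_goal 7 => intro i; fin_cases i
  all_goals
    ext j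
    fin_cases j <;> simp [triMul] <;> field_simp <;> ring

theorem hasNormalForm_square_swap₂₃ {k s : F}
    (h : HasNormalForm (triMul 0 1 0 0 k 0 0 s 0 0)) :
    HasNormalForm (triMul 1 0 0 0 0 k 0 0 0 s) := by
  refine MulIso.hasNormalForm (MulIso.triMul_of_matrix
    !![1, 0, 0, 0; 0, 0, 1, 0; 0, 1, 0, 0; 0, 0, 0, 1]
    !![1, 0, 0, 0; 0, 0, 1, 0; 0, 1, 0, 0; 0, 0, 0, 1] ?_ ?_ ?_ ?_ ?_ ?_ ?_ ?_) h
  · ext i j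
    fin_cases i <;> fin_cases j <;>
      simp [Matrix.mul_apply, Fin.sum_univ_four]
  on_goal 7 => intro i; fin_cases i
  all_goals
    ext j
    fin_cases j <;> simp [triMul]

theorem hasNormalForm_square_one [IsAlgClosed F] (e k s : F) :
    HasNormalForm (triMul 1 0 0 0 e k 0 0 0 s) := by
  by_cases he : e = 0
  · subst he
    exact hasNormalForm_square_swap₂₃ (hasNormalForm_pencil _ _ _ _ _ _)
  have h := hasNormalForm_cube_one (k / e) (s / e)
  refine MulIso.hasNormalForm (MulIso.triMul_of_matrix
    !![1, 0, 0, 0; 0, 1, 0, 0; 0, 0, 1, 0; 0, 0, 0, e]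
    !![1, 0, 0, 0; 0, 1, 0, 0; 0, 0, 1, 0; 0, 0, 0, e⁻¹] ?_ ?_ ?_ ?_ ?_ ?_ ?_ ?_) h
  · ext i j
    fin_cases i <;> fin_cases j <;>
      simp [Matrix.mul_apply, Fin.sum_univ_four] <;> field_simp
  on_goal 7 => intro i; fin_cases i
  all_goals
    ext j
    fin_cases j <;> simp [triMul] <;> field_simp

/-- Replace e₂ by e₁². Associativity then gives e₁²·e₃ = 0 and e₁²·e₁² = adk e₄, and ds = 0
separates the case where e₁³ has an e₃ component from the case s ≠ 0. -/
theorem hasNormalForm_of_square_ne_zero [IsAlgClosed F] {a b c d e k q r s : F} (ha : a ≠ 0)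
    (hq : a * q + b * r = d * k) (hr : a * r + b * s = 0) (hs : d * s = 0) :
    HasNormalForm (triMul a b c d e k 0 q r s) := by
  have h : HasNormalForm (triMul 1 0 0 (a * d) (a * e + b * k) k 0 (a * d * k) 0 s) := by
    by_cases hd : d = 0
    · subst hd
      simpa using hasNormalForm_square_one (a * e + b * k) k s
    · obtain rfl : s = 0 := by simpa [hd] using hs
      exact hasNormalForm_cube_ne_zero (mul_ne_zero ha hd)
  refine MulIso.hasNormalForm (MulIso.triMul_of_matrix
    !![1, 0, 0, 0; 0, a, b, c; 0, 0, 1, 0; 0, 0, 0, 1]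
    !![1, 0, 0, 0; 0, a⁻¹, -b / a, -c / a; 0, 0, 1, 0; 0, 0, 0, 1] ?_ ?_ ?_ ?_ ?_ ?_ ?_ ?_) h
  · ext i j
    fin_cases i <;> fin_cases j <;>
      simp [Matrix.mul_apply, Fin.sum_univ_four] <;> field_simp <;> ring
  on_goal 7 => intro i; fin_cases i
  all_goals
    ext j
    fin_cases j <;> simp [triMul] <;> first | ring1 | linear_combination a * hq + b * hr | linear_combination hr

/-! ### Case distinction from the associativity equations -/

theorem hasNormalForm_swap₁₂ {b c d e k p q r s : F}
    (h : HasNormalForm (triMul 0 p q d e r b c k s)) :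
    HasNormalForm (triMul 0 b c d e k p q r s) := by
  refine MulIso.hasNormalForm (MulIso.triMul_of_matrix
    !![0, 1, 0, 0; 1, 0, 0, 0; 0, 0, 1, 0; 0, 0, 0, 1]
    !![0, 1, 0, 0; 1, 0, 0, 0; 0, 0, 1, 0; 0, 0, 0, 1] ?_ ?_ ?_ ?_ ?_ ?_ ?_ ?_) h
  · ext i j
    fin_cases i <;> fin_cases j <;>
      simp [Matrix.mul_apply, Fin.sum_univ_four]
  on_goal 7 => intro i; fin_cases i
  all_goals
    ext j
    fin_cases j <;> simp [triMul]

/-- Put f = e₂ - (r/k)e₁. The two equations make fe₃ = 0 and place fe₁ and f² in the line of e₄. In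
the basis e₁, e₃, f, e₄ the square of the first vector has the nonzero coefficient b on the second,
so the previous case applies. -/
theorem hasNormalForm_square_isotropic [IsAlgClosed F] {b c d e k p q r : F} (hb : b ≠ 0)
    (hk : k ≠ 0) (hd : b * r = d * k) (hp : d * r = p * k) :
    HasNormalForm (triMul 0 b c d e k p q r 0) := by
  have h := hasNormalForm_of_square_ne_zero (a := b) (b := 0) (c := c) (d := 0) (e := k)
    (k := e - r * c / k) (q := 0) (r := 0) (s := q - 2 * (r / k) * e + (r / k) ^ 2 * c) hb
    (by simp) (by simp) (by simp)
  obtain rfl : d = b * r / k := by field_simp; exact hd.symm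
  obtain rfl : p = b * r ^ 2 / k ^ 2 := by
    field_simp at hp ⊢
    exact hp.symm
  refine MulIso.hasNormalForm (MulIso.triMul_of_matrix
    !![1, 0, 0, 0; 0, 0, 1, 0; -r / k, 1, 0, 0; 0, 0, 0, 1]
    !![1, 0, 0, 0; r / k, 0, 1, 0; 0, 1, 0, 0; 0, 0, 0, 1] ?_ ?_ ?_ ?_ ?_ ?_ ?_ ?_) h
  · ext i j
    fin_cases i <;> fin_cases j <;>
      simp [Matrix.mul_apply, Fin.sum_univ_four] <;> field_simp <;> ring
  on_goal 7 => intro i; fin_cases i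
  all_goals
    ext j
    fin_cases j <;> simp [triMul] <;> field_simp <;> ring

/-- The classification of the associative multiplications `triMul`. -/
theorem hasNormalForm_triMul [IsAlgClosed F] {a b c d e k p q r s : F}
    (hap : a * p = 0) (haq : a * q + b * r = d * k) (har : a * r + b * s = 0)
    (hds : d * s = 0) (hps : p * s = 0) (hdr : d * r = p * k) :
    HasNormalForm (triMul a b c d e k p q r s) := by
  by_cases ha : a = 0
  swap
  · obtain rfl : p = 0 := by simpa [ha] using hap
    exact hasNormalForm_of_square_ne_zero ha haq har hds
  subst ha
  simp only [zero_mul, zero_add] at haq har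
  by_cases hs : s = 0
  · subst hs
    by_cases hk : k = 0
    · subst hk
      by_cases hr : r = 0
      · subst hr
        exact hasNormalForm_pencil _ _ _ _ _ _
      obtain rfl : b = 0 := by simpa [hr] using haq
      obtain rfl : d = 0 := by simpa [hr] using hdr
      by_cases hp : p = 0
      · subst hp
        exact hasNormalForm_form _ _ _ _ _ _
      exact hasNormalForm_swap₁₂ (hasNormalForm_square_isotropic hp hr (by simp) (by simp))
    · by_cases hb : b = 0
      · subst hb
        obtain rfl : d = 0 := by simpa [hk] using haq.symm
        obtain rfl : p = 0 := by simpa [hk] using hdr.symm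
        exact hasNormalForm_form _ _ _ _ _ _
      · exact hasNormalForm_square_isotropic hb hk haq hdr
  · obtain rfl : b = 0 := by simpa [hs] using har
    obtain rfl : d = 0 := by simpa [hs] using hds
    obtain rfl : p = 0 := by simpa [hs] using hps
    exact hasNormalForm_form _ _ _ _ _ _

end NormalForms

/-! ### Engel's argument and strictly triangular bases -/

section Flag

variable {F : Type*} [Field F]

/-- A version of Engel's theorem: a proper ideal `W` of a commutative associative algebra with
nilpotent multiplication operators is annihilated modulo `W` by some vector outside `W`. -/
theorem exists_notMem_forall_mul_mem {V : Type*} [AddCommGroup V] [Module F V]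
    [FiniteDimensional F V] (m : V →ₗ[F] V →ₗ[F] V)
    (hcomm : ∀ x y, m x y = m y x) (hassoc : ∀ x y z, m (m x y) z = m x (m y z))
    (hnil : ∀ y, IsNilpotent (m y)) {W : Submodule F V} (hW : ∀ x ∈ W, ∀ y, m y x ∈ W)
    (hne : W ≠ ⊤) : ∃ x ∉ W, ∀ y, m y x ∈ W := by
  have hfin : ∀ s : Finset V, ∃ x ∉ W, ∀ y ∈ s, m y x ∈ W := by
    classical
    intro s
    induction s using Finset.induction_on with
    | empty =>
      obtain ⟨x, -, hx⟩ := SetLike.exists_of_lt (lt_top_iff_ne_top.mpr hne)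
      exact ⟨x, hx, by simp⟩
    | insert y s _ ih =>
      obtain ⟨x, hx, hs⟩ := ih
      -- The last iterate of x under m y that is still outside W is sent into W by m y. Since the
      -- multiplication operators commute and W is an ideal, it keeps the property for s.
      have hex : ∃ n, ((m y) ^ n) x ∈ W := by
        obtain ⟨n, hn⟩ := hnil y
        exact ⟨n, by simp [hn]⟩
      have hn := Nat.find_spec hex
      have hmin := fun k => Nat.find_min hex (m := k)
      generalize Nat.find hex = n at hn hmin
      rcases n with _ | n
      · exact absurd (by simpa using hn) hx
      refine ⟨((m y) ^ n) x, hmin n (Nat.lt_succ_self n), fun z hz => ?_⟩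
      rcases Finset.mem_insert.mp hz with rfl | hz
      · rwa [pow_succ'] at hn
      · have hc : Commute (m z) (m y) := by
          ext u
          change m z (m y u) = m y (m z u)
          rw [← hassoc, hcomm z y, hassoc]
        have := LinearMap.congr_fun (hc.pow_right n).eq x
        change m z (((m y) ^ n) x) = ((m y) ^ n) (m z x) at this
        rw [this]
        have hk : ∀ k : ℕ, ((m y) ^ k) (m z x) ∈ W := by
          intro k
          induction k with
          | zero => simpa using hs z hz
          | succ k ihk =>
            rw [pow_succ']
            exact hW _ ihk y
        exact hk n
  obtain ⟨s, hs⟩ := Module.finite_def.mp (inferInstance : Module.Finite F V)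
  obtain ⟨x, hx, h⟩ := hfin s
  refine ⟨x, hx, fun y => ?_⟩
  have htop : Submodule.span F (s : Set V) ≤ W.comap (m.flip x) :=
    Submodule.span_le.mpr fun y hy => h y hy
  rw [hs] at htop
  exact htop (Submodule.mem_top (x := y))

/-- A commutative associative algebra with nilpotent multiplication operators has linearly
independent families on which the multiplication is strictly triangular. -/
theorem exists_linearIndependent_triangular {V : Type*} [AddCommGroup V] [Module F V]
    [FiniteDimensional F V] (m : V →ₗ[F] V →ₗ[F] V)
    (hcomm : ∀ x y, m x y = m y x) (hassoc : ∀ x y z, m (m x y) z = m x (m y z))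
    (hnil : ∀ y, IsNilpotent (m y)) (n : ℕ) (hn : n ≤ Module.finrank F V) :
    ∃ v : Fin n → V, LinearIndependent F v ∧
      ∀ i y, m y (v i) ∈ Submodule.span F (v '' Set.Ioi i) := by
  induction n with
  | zero => exact ⟨Fin.elim0, linearIndependent_empty_type, fun i => i.elim0⟩
  | succ n ih =>
    obtain ⟨v, hv, hm⟩ := ih (by omega)
    obtain ⟨x, hx, hxm⟩ := exists_notMem_forall_mul_mem m hcomm hassoc hnil
      (W := Submodule.span F (Set.range v)) (by
        intro x hx y
        have hle : Submodule.span F (Set.range v) ≤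
            (Submodule.span F (Set.range v)).comap (m y) := by
          rw [Submodule.span_le]
          rintro _ ⟨i, rfl⟩
          exact Submodule.span_mono (Set.image_subset_range _ _) (hm i y)
        exact hle hx) (by
        intro h
        have h1 := finrank_span_eq_card hv
        rw [h, finrank_top, Fintype.card_fin] at h1
        omega)
    -- The new vector goes in front: its products lie in the span of the old family, and the old
    -- vectors keep their relative order.
    refine ⟨Fin.cons x v, linearIndependent_finCons.mpr ⟨hv, hx⟩, fun i y => ?_⟩
    refine Fin.cases ?_ (fun i => ?_) i
    · refine Submodule.span_mono ?_ (hxm y)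
      rintro _ ⟨j, rfl⟩
      exact ⟨j.succ, Fin.succ_pos j, by simp⟩
    · rw [Fin.cons_succ]
      refine Submodule.span_mono ?_ (hm i y)
      rintro _ ⟨j, hj, rfl⟩
      exact ⟨j.succ, Fin.succ_lt_succ_iff.mpr hj, by simp⟩

/-- The classification of commutative nilpotent associative algebra structures on `F ^ 4`. -/
theorem hasNormalForm_of_isNilpotent [IsAlgClosed F]
    (m : (Fin 4 → F) →ₗ[F] (Fin 4 → F) →ₗ[F] (Fin 4 → F))
    (hcomm : ∀ x y, m x y = m y x) (hassoc : ∀ x y z, m (m x y) z = m x (m y z))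
    (hnil : ∀ y, IsNilpotent (m y)) : HasNormalForm fun x y => m x y := by
  obtain ⟨v, hv, hm⟩ := exists_linearIndependent_triangular m hcomm hassoc hnil 4 (by simp)
  obtain ⟨B, rfl⟩ : ∃ B : Module.Basis (Fin 4) F (Fin 4 → F), ⇑B = v :=
    ⟨basisOfLinearIndependentOfCardEqFinrank hv (by simp), by simp⟩
  obtain ⟨c, hc⟩ : ∃ c : Fin 4 → Fin 4 → Fin 4 → F, ∀ i j l, c i j l = B.repr (m (B i) (B j)) l :=
    ⟨_, fun _ _ _ => rfl⟩
  have hsymm : ∀ i j l, c i j l = c j i l := fun i j l => by rw [hc, hc, hcomm]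
  have hzero : ∀ i j l, l ≤ j → c i j l = 0 := by
    intro i j l hl
    have h := (B.mem_span_image).mp (hm j (B i))
    rw [hc]
    by_contra hne
    exact absurd (h (Finsupp.mem_support_iff.mpr hne)) (not_lt.mpr hl)
  have hzero' : ∀ i j l, l ≤ i → c i j l = 0 := fun i j l hl => by rw [hsymm, hzero _ _ _ hl]
  have hT : ∀ x y, B.equivFun (m x y) = triMul (c 0 0 1) (c 0 0 2) (c 0 0 3) (c 0 1 2) (c 0 1 3)
      (c 0 2 3) (c 1 1 2) (c 1 1 3) (c 1 2 3) (c 2 2 3) (B.equivFun x) (B.equivFun y) := by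
    intro x y
    ext l
    have expand : B.equivFun (m x y) l =
        ∑ i, ∑ j, B.equivFun x i * B.equivFun y j * c i j l := by
      conv_lhs => rw [← B.sum_equivFun x, ← B.sum_equivFun y]
      simp only [map_sum, LinearMap.sum_apply, map_smul, LinearMap.smul_apply, Finset.sum_apply,
        Pi.smul_apply, smul_eq_mul, hc, Module.Basis.equivFun_apply, Finset.mul_sum]
      rw [Finset.sum_comm]
      exact Finset.sum_congr rfl fun i _ => Finset.sum_congr rfl fun j _ => by ring
    rw [expand]
    generalize B.equivFun x = x
    generalize B.equivFun y = y
    have h1 := hsymm 1 0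
    have h2 := hsymm 2 0
    have h3 := hsymm 2 1
    fin_cases l <;>
      simp [Fin.sum_univ_four, triMul, hzero, hzero', h1, h2, h3] <;> ring
  have hiso : MulIso (fun x y => m x y) (triMul (c 0 0 1) (c 0 0 2) (c 0 0 3) (c 0 1 2) (c 0 1 3)
      (c 0 2 3) (c 1 1 2) (c 1 1 3) (c 1 2 3) (c 2 2 3)) := ⟨B.equivFun, hT⟩
  refine hiso.symm.hasNormalForm ?_
  have hTassoc : ∀ x y z, triMul (c 0 0 1) (c 0 0 2) (c 0 0 3) (c 0 1 2) (c 0 1 3)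
      (c 0 2 3) (c 1 1 2) (c 1 1 3) (c 1 2 3) (c 2 2 3) (triMul (c 0 0 1) (c 0 0 2) (c 0 0 3)
      (c 0 1 2) (c 0 1 3) (c 0 2 3) (c 1 1 2) (c 1 1 3) (c 1 2 3) (c 2 2 3) x y) z =
      triMul (c 0 0 1) (c 0 0 2) (c 0 0 3) (c 0 1 2) (c 0 1 3)
      (c 0 2 3) (c 1 1 2) (c 1 1 3) (c 1 2 3) (c 2 2 3) x (triMul (c 0 0 1) (c 0 0 2) (c 0 0 3)
      (c 0 1 2) (c 0 1 3) (c 0 2 3) (c 1 1 2) (c 1 1 3) (c 1 2 3) (c 2 2 3) y z) := by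
    intro x y z
    obtain ⟨x, rfl⟩ := B.equivFun.surjective x
    obtain ⟨y, rfl⟩ := B.equivFun.surjective y
    obtain ⟨z, rfl⟩ := B.equivFun.surjective z
    rw [← hT, ← hT, ← hT, ← hT, hassoc]
  clear hT hiso hzero hzero' hsymm hc
  -- Associativity on the triples (e₁,e₁,e₂) (two coordinates), (e₁,e₁,e₃), (e₁,e₂,e₃), (e₂,e₂,e₃)
  -- and (e₁,e₂,e₂).
  refine hasNormalForm_triMul ?_ ?_ ?_ ?_ ?_ ?_
  · simpa [triMul, or_comm] using congrFun (hTassoc ![1, 0, 0, 0] ![1, 0, 0, 0] ![0, 1, 0, 0]) 2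
  · have h := congrFun (hTassoc ![1, 0, 0, 0] ![1, 0, 0, 0] ![0, 1, 0, 0]) 3
    simp [triMul] at h
    linear_combination h
  · have h := congrFun (hTassoc ![1, 0, 0, 0] ![1, 0, 0, 0] ![0, 0, 1, 0]) 3
    simp [triMul] at h
    linear_combination h
  · have h := congrFun (hTassoc ![1, 0, 0, 0] ![0, 1, 0, 0] ![0, 0, 1, 0]) 3
    simp [triMul] at h
    simpa [or_comm] using h
  · have h := congrFun (hTassoc ![0, 1, 0, 0] ![0, 1, 0, 0] ![0, 0, 1, 0]) 3
    simp [triMul] at h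
    simpa [or_comm] using h
  · have h := congrFun (hTassoc ![1, 0, 0, 0] ![0, 1, 0, 0] ![0, 1, 0, 0]) 3
    simp [triMul] at h
    linear_combination h

end Flag

/-! ### The right action of the affine group on points -/

section AffineAction

variable {n : ℕ} {F : Type*} [Field F]

/-- The right action of `AGL_n(F)` on `F ^ n`: the row `(1, v)` times `g` is `(1, aglAct g v)`. -/
def aglAct (g : AGL n F) (v : Fin n → F) : Fin n → F :=
  fun j => aglMatrix g 0 j.succ + ∑ i, v i * aglMatrix g i.succ j.succ

theorem aglMatrix_apply_zero (g : AGL n F) (i : Fin (n + 1)) :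
    aglMatrix g i 0 = if i = 0 then 1 else 0 := g.2 i

theorem cons_vecMul_aglMatrix (g : AGL n F) (v : Fin n → F) :
    Matrix.vecMul (Fin.cons 1 v : Fin (n + 1) → F) (aglMatrix g) = Fin.cons 1 (aglAct g v) := by
  ext j
  refine Fin.cases ?_ (fun j => ?_) j
  · simp [Matrix.vecMul, dotProduct, aglMatrix_apply_zero]
  · simp [Matrix.vecMul, dotProduct, Fin.sum_univ_succ, aglAct]

theorem aglAct_mul (g h : AGL n F) (v : Fin n → F) :
    aglAct (g * h) v = aglAct h (aglAct g v) := by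
  have h1 := cons_vecMul_aglMatrix (g * h) v
  rw [aglMatrix_mul, ← Matrix.vecMul_vecMul, cons_vecMul_aglMatrix, cons_vecMul_aglMatrix] at h1
  exact (Fin.cons_injective2 h1).2.symm

theorem aglAct_one (v : Fin n → F) : aglAct (1 : AGL n F) v = v := by
  have h1 := cons_vecMul_aglMatrix (1 : AGL n F) v
  rw [aglMatrix_one, Matrix.vecMul_one] at h1
  exact (Fin.cons_injective2 h1).2.symm

theorem aglAct_inv_aglAct (g : AGL n F) (v : Fin n → F) : aglAct g⁻¹ (aglAct g v) = v := by
  rw [← aglAct_mul, mul_inv_cancel, aglAct_one]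

theorem aglAct_aglAct_inv (g : AGL n F) (v : Fin n → F) : aglAct g (aglAct g⁻¹ v) = v := by
  rw [← aglAct_mul, inv_mul_cancel, aglAct_one]

/-- The linear part of an element of `AGL_n(F)`. -/
def aglLinear (g : AGL n F) : (Fin n → F) →ₗ[F] (Fin n → F) :=
  Matrix.vecMulLinear (Matrix.of fun i j => aglMatrix g i.succ j.succ)

theorem aglAct_eq_add (g : AGL n F) (v : Fin n → F) :
    aglAct g v = aglAct g 0 + aglLinear g v := by
  ext j
  simp [aglAct, aglLinear, Matrix.vecMul, dotProduct]

theorem aglMatrix_zero_eq_cons (g : AGL n F) : aglMatrix g 0 = Fin.cons 1 (aglAct g 0) := by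
  ext j
  refine Fin.cases ?_ (fun j => ?_) j
  · simp [aglMatrix_apply_zero]
  · simp [aglAct]

theorem aglMatrix_zero_eq_cons_iff (g : AGL n F) (v : Fin n → F) :
    aglMatrix g 0 = (Fin.cons 1 v : Fin (n + 1) → F) ↔ aglAct g 0 = v := by
  rw [aglMatrix_zero_eq_cons]
  exact ⟨fun h => (Fin.cons_injective2 h).2, fun h => by rw [h]⟩

/-- The rows (1, v) span: v = 0 gives the first row of the matrix, and then v = eᵢ gives the others.
-/
theorem aglMatrix_eq_of_vecMul {A : Matrix (Fin (n + 1)) (Fin (n + 1)) F} (g : AGL n F)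
    (h : ∀ v : Fin n → F, Matrix.vecMul (Fin.cons 1 v : Fin (n + 1) → F) A =
      Fin.cons 1 (aglAct g v)) : aglMatrix g = A := by
  have h' : ∀ v : Fin n → F, Matrix.vecMul (Fin.cons 1 v : Fin (n + 1) → F) (aglMatrix g) =
      Matrix.vecMul (Fin.cons 1 v : Fin (n + 1) → F) A := fun v => by
    rw [h, cons_vecMul_aglMatrix]
  have h0 : ∀ j, aglMatrix g 0 j = A 0 j := fun j => by
    simpa [Matrix.vecMul, dotProduct, Fin.sum_univ_succ] using congrFun (h' 0) j
  ext i j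
  refine Fin.cases (h0 j) (fun i => ?_) i
  simpa [Matrix.vecMul, dotProduct, Fin.sum_univ_succ, h0, Pi.single_apply]
    using congrFun (h' (Pi.single i 1)) j

theorem aglAct_injective {g h : AGL n F} (hgh : ∀ v, aglAct g v = aglAct h v) : g = h := by
  have : aglMatrix g = aglMatrix h :=
    aglMatrix_eq_of_vecMul g fun v => by rw [cons_vecMul_aglMatrix, hgh]
  exact Subtype.ext (Units.ext this)

/-- A linear automorphism of `F ^ n` as an element of `AGL_n(F)`. -/
theorem exists_aglAct_eq_linearEquiv (φ : (Fin n → F) ≃ₗ[F] (Fin n → F)) :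
    ∃ g : AGL n F, ∀ v, aglAct g v = φ v := by
  have hblock : ∀ ψ : (Fin n → F) ≃ₗ[F] (Fin n → F),
      ∃ A : Matrix (Fin (n + 1)) (Fin (n + 1)) F,
        (∀ i, A i 0 = if i = 0 then 1 else 0) ∧ (∀ j, A 0 j = if j = 0 then 1 else 0) ∧
        ∀ i j : Fin n, A i.succ j.succ = ψ (Pi.single i 1) j := by
    intro ψ
    refine ⟨Matrix.of (Fin.cons (Fin.cons 1 0) fun i => Fin.cons 0 (ψ (Pi.single i 1))), ?_, ?_,
      ?_⟩
    · intro i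
      refine Fin.cases ?_ (fun i => ?_) i <;> simp
    · intro i
      refine Fin.cases ?_ (fun i => ?_) i <;> simp
    · simp
  have hmul : ∀ (ψ χ : (Fin n → F) ≃ₗ[F] (Fin n → F)) (A B : Matrix (Fin (n + 1)) (Fin (n + 1)) F),
      (∀ v, χ (ψ v) = v) →
      (∀ i, A i 0 = if i = 0 then 1 else 0) → (∀ j, A 0 j = if j = 0 then 1 else 0) →
      (∀ i j : Fin n, A i.succ j.succ = ψ (Pi.single i 1) j) →
      (∀ i, B i 0 = if i = 0 then 1 else 0) → (∀ j, B 0 j = if j = 0 then 1 else 0) →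
      (∀ i j : Fin n, B i.succ j.succ = χ (Pi.single i 1) j) → A * B = 1 := by
    intro ψ χ A B hχ hA hA' hAψ hB hB' hBχ
    ext i j
    rw [Matrix.mul_apply, Fin.sum_univ_succ]
    refine Fin.cases ?_ (fun i => ?_) i
    · simp [hA', hB', Matrix.one_apply, eq_comm]
    · refine Fin.cases ?_ (fun j => ?_) j
      · simp [hA, hB]
      · have h1 : ψ (Pi.single i 1) = ∑ l, ψ (Pi.single i 1) l • (Pi.single l 1 : Fin n → F) := by
          ext l
          simp [Finset.sum_apply, Pi.single_apply]
        have h2 := congrFun (hχ (Pi.single i 1)) j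
        rw [h1, map_sum, Finset.sum_apply] at h2
        simp only [map_smul, Pi.smul_apply, smul_eq_mul] at h2
        simp [hA, hAψ, hBχ, h2, Matrix.one_apply, Pi.single_apply, eq_comm]
  obtain ⟨A, hA, hA', hAφ⟩ := hblock φ
  obtain ⟨B, hB, hB', hBφ⟩ := hblock φ.symm
  refine ⟨⟨⟨A, B, hmul φ φ.symm A B (by simp) hA hA' hAφ hB hB' hBφ,
    hmul φ.symm φ B A (by simp) hB hB' hBφ hA hA' hAφ⟩, hA⟩, fun v => ?_⟩
  ext j
  have h1 : v = ∑ l, v l • (Pi.single l 1 : Fin n → F) := by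
    ext l
    simp [Finset.sum_apply, Pi.single_apply]
  conv_rhs => rw [h1, map_sum]
  simp [aglAct, aglMatrix, hA', hAφ]

end AffineAction

/-! ### From abelian regular subgroups to nilpotent algebras -/

theorem isNilpotent_of_forall_eigenvalue_eq_zero {F V : Type*} [Field F] [IsAlgClosed F]
    [AddCommGroup V] [Module F V] [FiniteDimensional F V] {f : Module.End F V}
    (h : ∀ c : F, c ≠ 0 → ∀ x, f x = c • x → x = 0) : IsNilpotent f := by
  have hroots : ∀ c ∈ f.charpoly.roots, c = 0 := by
    intro c hc
    by_contra hne
    obtain ⟨x, hx⟩ := (Module.End.hasEigenvalue_iff_isRoot_charpoly f c).mpr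
      (Polynomial.isRoot_of_mem_roots hc) |>.exists_hasEigenvector
    exact hx.2 (h c hne x hx.apply_eq_smul)
  -- The characteristic polynomial splits with all roots 0, so it is a power of X, and
  -- Cayley–Hamilton applies.
  have hX := (IsAlgClosed.splits f.charpoly).eq_prod_roots_of_monic f.charpoly_monic
  rw [Multiset.eq_replicate_of_mem hroots] at hX
  have := f.aeval_self_charpoly
  rw [hX] at this
  exact ⟨_, by simpa using this⟩

section Correspondence

variable {n : ℕ} {F : Type*} [Field F]

/-- The subgroup `R` of `AGL_n(F)` consists of the affine maps `v ↦ v + w + m(v, w)`. -/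
def InducesSubgroup (m : (Fin n → F) → (Fin n → F) → (Fin n → F)) (R : Subgroup (AGL n F)) : Prop :=
  ∀ g : AGL n F, g ∈ R ↔ ∃ w, ∀ v, aglAct g v = v + w + m v w

/-- Every abelian regular subgroup is induced by a commutative associative multiplication, with
nilpotent multiplication operators if the field is algebraically closed. -/
theorem IsAbelianRegular.exists_inducesSubgroup [IsAlgClosed F] {R : Subgroup (AGL n F)}
    (hR : IsAbelianRegular R) : ∃ m : (Fin n → F) →ₗ[F] (Fin n → F) →ₗ[F] (Fin n → F),
      (∀ x y, m x y = m y x) ∧ (∀ x y z, m (m x y) z = m x (m y z)) ∧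
      (∀ y, IsNilpotent (m y)) ∧ InducesSubgroup (fun x y => m x y) R := by
  obtain ⟨hab, hreg⟩ := hR
  choose γ hγ huniq using hreg
  simp only [aglMatrix_zero_eq_cons_iff] at hγ huniq
  have hγR : ∀ w, γ w ∈ R := fun w => (hγ w).1
  have hγ0 : ∀ w, aglAct (γ w) 0 = w := fun w => (hγ w).2
  have huniq' : ∀ g ∈ R, g = γ (aglAct g 0) := fun g hg => huniq _ g ⟨hg, rfl⟩
  -- Both sides are the image of 0 under the product of γ v and γ w, in the two orders.
  have hsymm : ∀ v w, aglAct (γ w) v = aglAct (γ v) w := by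
    intro v w
    conv_lhs => rw [← hγ0 v]
    conv_rhs => rw [← hγ0 w]
    rw [← aglAct_mul, ← aglAct_mul, hab _ (hγR v) _ (hγR w)]
  have hlin : ∀ v w, aglAct (γ w) v = w + aglLinear (γ w) v := fun v w => by
    rw [aglAct_eq_add, hγ0]
  have hcomm : ∀ v w, aglLinear (γ w) v - v = aglLinear (γ v) w - w := by
    intro v w
    have h := hsymm v w
    rw [hlin, hlin] at h
    rw [eq_sub_of_add_eq' h]
    abel
  obtain ⟨m, hm⟩ : ∃ m : (Fin n → F) →ₗ[F] (Fin n → F) →ₗ[F] (Fin n → F),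
      ∀ v w, m v w = aglLinear (γ w) v - v := by
    refine ⟨LinearMap.mk₂ F (fun v w => aglLinear (γ w) v - v) ?_ ?_ ?_ ?_, fun _ _ => rfl⟩
    · intro v v' w
      rw [map_add]
      abel
    · intro t v w
      rw [map_smul, smul_sub]
    -- Linearity in w is not visible from the definition; it is transported from v by symmetry.
    · intro v w w'
      rw [hcomm, hcomm v w, hcomm v w', map_add]
      abel
    · intro t v w
      rw [hcomm, hcomm v w, map_smul, smul_sub]
  have hact : ∀ v w, aglAct (γ w) v = v + w + m v w := fun v w => by
    rw [hlin, hm]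
    abel
  have hmcomm : ∀ x y, m x y = m y x := fun x y => by rw [hm, hm, hcomm]
  refine ⟨m, hmcomm, ?_, ?_, ?_⟩
  · intro u v w
    -- Both elements of R move 0 to the same point. Comparing their effect on u gives associativity.
    have h1 : γ v * γ w = γ (v + w + m v w) := by
      have h := huniq' _ (R.mul_mem (hγR v) (hγR w))
      rwa [aglAct_mul, hγ0, hact] at h
    have h2 := congrArg (fun g => aglAct g u) h1
    simp only [aglAct_mul, hact, map_add, LinearMap.add_apply] at h2
    have h3 : ∀ a b c d : Fin n → F, a = b → c - a = d - b → c = d := by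
      intro a b c d hab hcd
      rw [hab] at hcd
      exact sub_left_injective hcd
    refine h3 _ _ _ _ h2 ?_
    abel
  · intro y
    have hev : ∀ c : F, c ≠ 0 → ∀ x, m y x = c • x → x = 0 := by
      intro c hc x hx
      -- An eigenvector x of m y for c ≠ 0 would be sent by this element to the same point as 0,
      -- against injectivity.
      have h1 : aglAct (γ (-c⁻¹ • y)) x = aglAct (γ (-c⁻¹ • y)) 0 := by
        rw [hact, hact, map_smul, hmcomm x y, hx]
        simp [hc, smul_smul]
      have h2 := congrArg (aglAct (γ (-c⁻¹ • y))⁻¹) h1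
      rwa [aglAct_inv_aglAct, aglAct_inv_aglAct] at h2
    exact isNilpotent_of_forall_eigenvalue_eq_zero hev
  · intro g
    constructor
    · intro hg
      refine ⟨aglAct g 0, fun v => ?_⟩
      conv_lhs => rw [huniq' g hg]
      rw [hact]
    · rintro ⟨w, hw⟩
      have : g = γ w := aglAct_injective fun v => by rw [hw, hact]
      rw [this]
      exact hγR w

end Correspondence

/-! ### Conjugacy of subgroups and isomorphism of algebras -/

section Conjugacy

variable {F : Type*} [Field F] {m m' : (Fin 4 → F) → (Fin 4 → F) → (Fin 4 → F)}
  {R S : Subgroup (AGL 4 F)}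

theorem MulIso.isConjSubgroup (h : MulIso m m') (hR : InducesSubgroup m R)
    (hS : InducesSubgroup m' S) : IsConjSubgroup R S := by
  obtain ⟨φ, hφ⟩ := h
  obtain ⟨g, hg⟩ := exists_aglAct_eq_linearEquiv φ.symm
  have hg' : ∀ v, aglAct g⁻¹ v = φ v := fun v => by
    have := aglAct_aglAct_inv g v
    rwa [hg, LinearEquiv.symm_apply_eq] at this
  have key : ∀ x, g⁻¹ * x * g ∈ R ↔ x ∈ S := by
    intro x
    have hact : ∀ v, aglAct (g⁻¹ * x * g) v = φ.symm (aglAct x (φ v)) := fun v => by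
      rw [aglAct_mul, aglAct_mul, hg, hg']
    rw [hR, hS]
    constructor
    · rintro ⟨w, hw⟩
      refine ⟨φ w, fun v => ?_⟩
      have h1 := hw (φ.symm v)
      rw [hact, LinearEquiv.symm_apply_eq] at h1
      simpa [hφ] using h1
    · rintro ⟨w, hw⟩
      refine ⟨φ.symm w, fun v => ?_⟩
      rw [hact, LinearEquiv.symm_apply_eq, hw]
      simp [hφ]
  refine ⟨g, ?_⟩
  ext x
  constructor
  · rintro ⟨r, hr, rfl⟩
    rw [← key]
    simpa [mul_assoc] using hr
  · intro hx
    exact ⟨g⁻¹ * x * g, (key x).mpr hx, by simp [mul_assoc]⟩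

theorem IsConjSubgroup.mulIso (h : IsConjSubgroup R S) (hreg : IsRegularSubgroup R)
    (hR : InducesSubgroup m R) (hS : InducesSubgroup m' S) (hm : ∀ w, m 0 w = 0)
    (hm' : ∀ w, m' 0 w = 0) : MulIso m m' := by
  obtain ⟨g, rfl⟩ := h
  have hex : ∀ w, ∃ r ∈ R, ∀ v, aglAct r v = v + w + m v w := by
    intro w
    obtain ⟨r, ⟨hr, hr0⟩, -⟩ := hreg w
    rw [aglMatrix_zero_eq_cons_iff] at hr0
    obtain ⟨w', hw'⟩ := (hR r).mp hr
    have h0 := hw' 0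
    rw [hr0, hm] at h0
    obtain rfl : w = w' := by simpa using h0
    exact ⟨r, hr, hw'⟩
  -- Take r₀ in R agreeing with g at 0 and write g = h * r₀. Then h fixes 0, so it is linear, and it
  -- conjugates R to the same subgroup as g. The isomorphism is the action of h⁻¹, since the action
  -- is on the right.
  obtain ⟨r₀, hr₀, hact₀⟩ := hex (aglAct g 0)
  obtain ⟨h, rfl⟩ : ∃ h, g = h * r₀ := ⟨g * r₀⁻¹, by simp⟩
  have hh0 : aglAct h 0 = 0 := by
    have h1 := hact₀ 0
    rw [hm, add_zero, zero_add, aglAct_mul] at h1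
    have h2 := congrArg (aglAct r₀⁻¹) h1
    rw [aglAct_inv_aglAct, aglAct_inv_aglAct] at h2
    exact h2.symm
  have hh0' : aglAct h⁻¹ 0 = 0 := by
    conv_lhs => rw [← hh0]
    exact aglAct_inv_aglAct _ _
  have hlin : ∀ v, aglAct h v = aglLinear h v := fun v => by rw [aglAct_eq_add, hh0, zero_add]
  have hlin' : ∀ v, aglAct h⁻¹ v = aglLinear h⁻¹ v := fun v => by
    rw [aglAct_eq_add, hh0', zero_add]
  refine ⟨LinearEquiv.ofLinearMap (aglLinear h⁻¹) (aglLinear h) (LinearMap.ext fun x => ?_)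
    (LinearMap.ext fun x => ?_), fun x w => ?_⟩
  · simp only [LinearMap.comp_apply, ← hlin, ← hlin', aglAct_inv_aglAct, LinearMap.id_apply]
  · simp only [LinearMap.comp_apply, ← hlin, ← hlin', aglAct_aglAct_inv, LinearMap.id_apply]
  · change aglLinear h⁻¹ (m x w) = m' (aglLinear h⁻¹ x) (aglLinear h⁻¹ w)
    obtain ⟨r, hr, hact⟩ := hex w
    have hmem : h * r * h⁻¹ ∈ R.map (MulAut.conj (h * r₀)).toMonoidHom :=
      ⟨r₀⁻¹ * r * r₀, R.mul_mem (R.mul_mem (R.inv_mem hr₀) hr) hr₀, by simp [mul_assoc]⟩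
    obtain ⟨w', hw'⟩ := (hS _).mp hmem
    have h0 := hw' 0
    rw [aglAct_mul, aglAct_mul, hh0, hact, hm, hm', zero_add, zero_add, add_zero, add_zero,
      hlin'] at h0
    subst h0
    have h1 := hw' (aglAct h⁻¹ x)
    rw [aglAct_mul, aglAct_mul, aglAct_aglAct_inv, hact, hlin', hlin', map_add, map_add] at h1
    exact add_left_cancel h1

end Conjugacy

/-! ### Subgroups given by a matrix pattern -/

section ParamSubgroup

variable {F : Type*} [Field F] {M : F → F → F → F → Matrix (Fin 5) (Fin 5) F}
    {hone : ∃ x₁ x₂ x₃ x₄, 1 = M x₁ x₂ x₃ x₄}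
    {hmul : ∀ x₁ x₂ x₃ x₄ y₁ y₂ y₃ y₄, ∃ z₁ z₂ z₃ z₄,
      M x₁ x₂ x₃ x₄ * M y₁ y₂ y₃ y₄ = M z₁ z₂ z₃ z₄}
    {hinv : ∀ x₁ x₂ x₃ x₄, ∃ y₁ y₂ y₃ y₄, M x₁ x₂ x₃ x₄ * M y₁ y₂ y₃ y₄ = 1}

theorem isAbelianRegular_paramSubgroup
    (hrow : ∀ x₁ x₂ x₃ x₄, M x₁ x₂ x₃ x₄ 0 = ![1, x₁, x₂, x₃, x₄])
    (hcol : ∀ x₁ x₂ x₃ x₄ i, M x₁ x₂ x₃ x₄ i 0 = if i = 0 then 1 else 0)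
    (hcomm : ∀ x₁ x₂ x₃ x₄ y₁ y₂ y₃ y₄,
      M x₁ x₂ x₃ x₄ * M y₁ y₂ y₃ y₄ = M y₁ y₂ y₃ y₄ * M x₁ x₂ x₃ x₄) :
    IsAbelianRegular (paramSubgroup M hone hmul hinv) := by
  constructor
  · rintro a ⟨x₁, x₂, x₃, x₄, ha⟩ b ⟨y₁, y₂, y₃, y₄, hb⟩
    refine Subtype.ext (Units.ext ?_)
    change aglMatrix (a * b) = aglMatrix (b * a)
    rw [aglMatrix_mul, aglMatrix_mul, ha, hb, hcomm]
  · intro v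
    obtain ⟨y₁, y₂, y₃, y₄, hy⟩ := hinv (v 0) (v 1) (v 2) (v 3)
    refine ⟨⟨⟨M (v 0) (v 1) (v 2) (v 3), M y₁ y₂ y₃ y₄, hy, mul_eq_one_comm.mp hy⟩,
      hcol _ _ _ _⟩, ⟨⟨v 0, v 1, v 2, v 3, rfl⟩, ?_⟩, ?_⟩
    · refine (hrow _ _ _ _).trans ?_
      ext i
      fin_cases i <;> rfl
    · rintro g ⟨⟨x₁, x₂, x₃, x₄, hg⟩, hv⟩
      refine Subtype.ext (Units.ext ?_)
      change aglMatrix g = M (v 0) (v 1) (v 2) (v 3)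
      rw [hg, hrow] at hv
      obtain rfl : v = ![x₁, x₂, x₃, x₄] := (Fin.cons_injective2 (α := fun _ => F) hv).2.symm
      exact hg

theorem inducesSubgroup_paramSubgroup {m : (Fin 4 → F) → (Fin 4 → F) → (Fin 4 → F)}
    (hM : ∀ (v : Fin 4 → F) x₁ x₂ x₃ x₄,
      Matrix.vecMul (Fin.cons 1 v : Fin 5 → F) (M x₁ x₂ x₃ x₄) =
        Fin.cons 1 (v + ![x₁, x₂, x₃, x₄] + m v ![x₁, x₂, x₃, x₄])) :
    InducesSubgroup m (paramSubgroup M hone hmul hinv) := by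
  intro g
  constructor
  · rintro ⟨x₁, x₂, x₃, x₄, hg⟩
    refine ⟨![x₁, x₂, x₃, x₄], fun v => ?_⟩
    have h := cons_vecMul_aglMatrix g v
    rw [hg, hM] at h
    exact (Fin.cons_injective2 (α := fun _ => F) h).2.symm
  · rintro ⟨w, hw⟩
    refine ⟨w 0, w 1, w 2, w 3, aglMatrix_eq_of_vecMul g fun v => ?_⟩
    have h4 : ![w 0, w 1, w 2, w 3] = w := by
      ext i
      fin_cases i <;> rfl
    rw [hM, h4, hw]

end ParamSubgroup

/-! ### The listed subgroups and their algebras -/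

section Representatives

variable (F : Type*) [Field F]

theorem isAbelianRegular_subgroupS5 : IsAbelianRegular (subgroupS5 F) := by
  refine isAbelianRegular_paramSubgroup (fun _ _ _ _ => rfl) ?_ ?_
  · intro x₁ x₂ x₃ x₄ i
    fin_cases i <;> simp
  · intro x₁ x₂ x₃ x₄ y₁ y₂ y₃ y₄
    ext i j
    fin_cases i <;> fin_cases j <;> simp [Matrix.mul_apply, Fin.sum_univ_succ] <;> ring

theorem inducesSubgroup_subgroupS5 :
    InducesSubgroup (triMul (1 : F) 0 0 1 0 1 0 1 0 0) (subgroupS5 F) := by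
  refine inducesSubgroup_paramSubgroup fun v x₁ x₂ x₃ x₄ => ?_
  ext j
  refine Fin.cases ?_ (fun j => ?_) j
  · simp [Matrix.vecMul, dotProduct, Fin.sum_univ_succ]
  · fin_cases j <;>
      simp [Matrix.vecMul, dotProduct, Fin.sum_univ_succ, triMul, Matrix.vecHead,
        Matrix.vecTail] <;> ring

theorem isAbelianRegular_subgroupS41 : IsAbelianRegular (subgroupS41 F) := by
  refine isAbelianRegular_paramSubgroup (fun _ _ _ _ => rfl) ?_ ?_
  · intro x₁ x₂ x₃ x₄ i
    fin_cases i <;> simp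
  · intro x₁ x₂ x₃ x₄ y₁ y₂ y₃ y₄
    ext i j
    fin_cases i <;> fin_cases j <;> simp [Matrix.mul_apply, Fin.sum_univ_succ] <;> ring

theorem inducesSubgroup_subgroupS41 :
    InducesSubgroup (triMul (1 : F) 0 0 1 0 0 0 0 0 0) (subgroupS41 F) := by
  refine inducesSubgroup_paramSubgroup fun v x₁ x₂ x₃ x₄ => ?_
  ext j
  refine Fin.cases ?_ (fun j => ?_) j
  · simp [Matrix.vecMul, dotProduct, Fin.sum_univ_succ]
  · fin_cases j <;>
      simp [Matrix.vecMul, dotProduct, Fin.sum_univ_succ, triMul, Matrix.vecHead,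
        Matrix.vecTail] <;> ring

theorem isAbelianRegular_subgroupS32sharp : IsAbelianRegular (subgroupS32sharp F) := by
  refine isAbelianRegular_paramSubgroup (fun _ _ _ _ => rfl) ?_ ?_
  · intro x₁ x₂ x₃ x₄ i
    fin_cases i <;> simp
  · intro x₁ x₂ x₃ x₄ y₁ y₂ y₃ y₄
    ext i j
    fin_cases i <;> fin_cases j <;> simp [Matrix.mul_apply, Fin.sum_univ_succ] <;> ring

theorem inducesSubgroup_subgroupS32sharp :
    InducesSubgroup (triMul (1 : F) 0 0 0 1 0 0 0 0 1) (subgroupS32sharp F) := by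
  refine inducesSubgroup_paramSubgroup fun v x₁ x₂ x₃ x₄ => ?_
  ext j
  refine Fin.cases ?_ (fun j => ?_) j
  · simp [Matrix.vecMul, dotProduct, Fin.sum_univ_succ]
  · fin_cases j <;>
      simp [Matrix.vecMul, dotProduct, Fin.sum_univ_succ, triMul, Matrix.vecHead,
        Matrix.vecTail] <;> ring

theorem isAbelianRegular_subgroupTr4 : IsAbelianRegular (subgroupTr4 F) := by
  refine isAbelianRegular_paramSubgroup (fun _ _ _ _ => rfl) ?_ ?_
  · intro x₁ x₂ x₃ x₄ i
    fin_cases i <;> simp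
  · intro x₁ x₂ x₃ x₄ y₁ y₂ y₃ y₄
    ext i j
    fin_cases i <;> fin_cases j <;> simp [Matrix.mul_apply, Fin.sum_univ_succ] <;> ring

theorem inducesSubgroup_subgroupTr4 :
    InducesSubgroup (triMul (0 : F) 0 0 0 0 0 0 0 0 0) (subgroupTr4 F) := by
  refine inducesSubgroup_paramSubgroup fun v x₁ x₂ x₃ x₄ => ?_
  ext j
  refine Fin.cases ?_ (fun j => ?_) j
  · simp [Matrix.vecMul, dotProduct, Fin.sum_univ_succ]
  · fin_cases j <;>
      simp [Matrix.vecMul, dotProduct, Fin.sum_univ_succ, triMul, Matrix.vecHead,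
        Matrix.vecTail] <;> ring

variable {F}

theorem isAbelianRegular_subgroupU1 (α β : F) : IsAbelianRegular (subgroupU1 α β) := by
  refine isAbelianRegular_paramSubgroup (fun _ _ _ _ => rfl) ?_ ?_
  · intro x₁ x₂ x₃ x₄ i
    fin_cases i <;> simp
  · intro x₁ x₂ x₃ x₄ y₁ y₂ y₃ y₄
    ext i j
    fin_cases i <;> fin_cases j <;> simp [Matrix.mul_apply, Fin.sum_univ_succ] <;> ring

theorem inducesSubgroup_subgroupU1 (α β : F) :
    InducesSubgroup (triMul 0 1 0 0 1 0 β α 0 0) (subgroupU1 α β) := by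
  refine inducesSubgroup_paramSubgroup fun v x₁ x₂ x₃ x₄ => ?_
  ext j
  refine Fin.cases ?_ (fun j => ?_) j
  · simp [Matrix.vecMul, dotProduct, Fin.sum_univ_succ]
  · fin_cases j <;>
      simp [Matrix.vecMul, dotProduct, Fin.sum_univ_succ, triMul, Matrix.vecHead,
        Matrix.vecTail] <;> ring

theorem isAbelianRegular_subgroupRD {D : Matrix (Fin 3) (Fin 3) F} (hD : D.IsSymm) : IsAbelianRegular (subgroupRD D) := by
  refine isAbelianRegular_paramSubgroup (fun _ _ _ _ => rfl) ?_ ?_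
  · intro x₁ x₂ x₃ x₄ i
    fin_cases i <;> simp
  · intro x₁ x₂ x₃ x₄ y₁ y₂ y₃ y₄
    ext i j
    fin_cases i <;> fin_cases j <;> simp [Matrix.mul_apply, Fin.sum_univ_succ, hD.apply 0 1, hD.apply 0 2, hD.apply 1 2] <;> ring

theorem inducesSubgroup_subgroupRD {D : Matrix (Fin 3) (Fin 3) F} (hD : D.IsSymm) :
    InducesSubgroup (triMul 0 0 (D 0 0) 0 (D 0 1) (D 0 2) 0 (D 1 1) (D 1 2) (D 2 2)) (subgroupRD D) := by
  refine inducesSubgroup_paramSubgroup fun v x₁ x₂ x₃ x₄ => ?_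
  ext j
  refine Fin.cases ?_ (fun j => ?_) j
  · simp [Matrix.vecMul, dotProduct, Fin.sum_univ_succ]
  · fin_cases j <;>
      simp [Matrix.vecMul, dotProduct, Fin.sum_univ_succ, triMul, Matrix.vecHead,
        Matrix.vecTail, hD.apply 0 1, hD.apply 0 2, hD.apply 1 2] <;> ring

end Representatives

/-! ### Separating the normal forms -/

section Invariants

variable {F : Type*} [Field F]

open Classical in
/-- A number that depends only on the isomorphism class of the multiplication and tells the normal
forms apart. -/
noncomputable def mulInvariant (m : (Fin 4 → F) → (Fin 4 → F) → (Fin 4 → F)) : ℕ :=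
  -- Writing A for the algebra, the tests ask in turn whether A³ and A⁴ vanish, whether some
  -- annihilating vector is not a product, whether two products are nonproportional, and whether a
  -- vector of square zero can fail to annihilate A. When the products are proportional, these tests
  -- find the rank of the form, and values 8 and 9 belong to forms with all squares zero.
  if ∃ x y z, m (m x y) z ≠ 0 then
    if ∃ x y z w, m (m (m x y) z) w ≠ 0 then 0
    else if ∃ x, (∀ y, m x y = 0) ∧ ∀ y z, m y z ≠ x then 1 else 2
  else if ∃ x y z w, m x y ≠ 0 ∧ ∀ t : F, m z w ≠ t • m x y then
    if ∃ x y, m x x = 0 ∧ m x y ≠ 0 then 3 else 4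
  else if ∃ x, m x x ≠ 0 then
    if ∃ x y, m x x = 0 ∧ m x y ≠ 0 then
      if ∃ x, (∀ y, m x y = 0) ∧ ∀ y z, m y z ≠ x then 6 else 7
    else 5
  else if ∃ x y, m x y ≠ 0 then 9 else 8

theorem MulIso.mulInvariant_eq {m m' : (Fin 4 → F) → (Fin 4 → F) → (Fin 4 → F)}
    (h : MulIso m m') : mulInvariant m = mulInvariant m' := by
  obtain ⟨φ, hφ⟩ := h
  have ex : ∀ {P Q : (Fin 4 → F) → Prop}, (∀ x, P x ↔ Q (φ x)) → ((∃ x, P x) ↔ ∃ x, Q x) :=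
    fun h => φ.toEquiv.exists_congr h
  have all : ∀ {P Q : (Fin 4 → F) → Prop}, (∀ x, P x ↔ Q (φ x)) → ((∀ x, P x) ↔ ∀ x, Q x) :=
    fun h => φ.toEquiv.forall_congr h
  have e1 : (∃ x y z, m (m x y) z ≠ 0) ↔ ∃ x y z, m' (m' x y) z ≠ 0 :=
    ex fun x => ex fun y => ex fun z => by simp [← hφ]
  have e2 : (∃ x y z w, m (m (m x y) z) w ≠ 0) ↔ ∃ x y z w, m' (m' (m' x y) z) w ≠ 0 :=
    ex fun x => ex fun y => ex fun z => ex fun w => by simp [← hφ]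
  have e3 : (∃ x, (∀ y, m x y = 0) ∧ ∀ y z, m y z ≠ x) ↔
      ∃ x, (∀ y, m' x y = 0) ∧ ∀ y z, m' y z ≠ x :=
    ex fun x => and_congr (all fun y => by simp [← hφ])
      (all fun y => all fun z => by simp [← hφ])
  have e4 : (∃ x y z w, m x y ≠ 0 ∧ ∀ t : F, m z w ≠ t • m x y) ↔
      ∃ x y z w, m' x y ≠ 0 ∧ ∀ t : F, m' z w ≠ t • m' x y :=
    ex fun x => ex fun y => ex fun z => ex fun w => by simp [← hφ, ← map_smul]
  have e5 : (∃ x y, m x x = 0 ∧ m x y ≠ 0) ↔ ∃ x y, m' x x = 0 ∧ m' x y ≠ 0 :=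
    ex fun x => ex fun y => by simp [← hφ]
  have e6 : (∃ x, m x x ≠ 0) ↔ ∃ x, m' x x ≠ 0 := ex fun x => by simp [← hφ]
  have e7 : (∃ x y, m x y ≠ 0) ↔ ∃ x y, m' x y ≠ 0 := ex fun x => ex fun y => by simp [← hφ]
  rw [mulInvariant, mulInvariant, propext e1, propext e2, propext e3, propext e4, propext e5,
    propext e6, propext e7]

theorem mulInvariant_S5 : mulInvariant (triMul (1 : F) 0 0 1 0 1 0 1 0 0) = 0 := by
  have h1 : ∃ x y z, triMul (1 : F) 0 0 1 0 1 0 1 0 0 (triMul 1 0 0 1 0 1 0 1 0 0 x y) z ≠ 0 :=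
    ⟨![1, 0, 0, 0], ![1, 0, 0, 0], ![1, 0, 0, 0], by simp [triMul]⟩
  have h2 : ∃ x y z w, triMul (1 : F) 0 0 1 0 1 0 1 0 0 (triMul 1 0 0 1 0 1 0 1 0 0
      (triMul 1 0 0 1 0 1 0 1 0 0 x y) z) w ≠ 0 :=
    ⟨![1, 0, 0, 0], ![1, 0, 0, 0], ![1, 0, 0, 0], ![1, 0, 0, 0], by simp [triMul]⟩
  rw [mulInvariant, if_pos h1, if_pos h2]

theorem mulInvariant_S41 : mulInvariant (triMul (1 : F) 0 0 1 0 0 0 0 0 0) = 1 := by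
  rw [mulInvariant, if_pos ⟨![1, 0, 0, 0], ![1, 0, 0, 0], ![1, 0, 0, 0], by simp [triMul]⟩,
    if_neg (by simp [triMul]), if_pos ⟨![0, 0, 0, 1], by simp [triMul]⟩]

theorem mulInvariant_S32sharp : mulInvariant (triMul (1 : F) 0 0 0 1 0 0 0 0 1) = 2 := by
  rw [mulInvariant, if_pos ⟨![1, 0, 0, 0], ![1, 0, 0, 0], ![1, 0, 0, 0], by simp [triMul]⟩,
    if_neg (by simp [triMul]), if_neg]
  rintro ⟨x, hx, hne⟩
  have h0 := congrFun (hx ![1, 0, 0, 0]) 1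
  have h1 := congrFun (hx ![1, 0, 0, 0]) 3
  have h2 := congrFun (hx ![0, 0, 1, 0]) 3
  simp [triMul] at h0 h1 h2
  -- The annihilator is the line of e₄, and e₃ · (x₄e₃) = x₄e₄ reaches all of it.
  refine hne ![0, 0, 1, 0] ![0, 0, x 3, 0] ?_
  ext i
  fin_cases i <;> simp [triMul, h0, h1, h2]

theorem mulInvariant_U1_zero : mulInvariant (triMul (0 : F) 1 0 0 1 0 0 0 0 0) = 3 := by
  rw [mulInvariant, if_neg (by simp [triMul]), if_pos
    ⟨![1, 0, 0, 0], ![1, 0, 0, 0], ![1, 0, 0, 0], ![0, 1, 0, 0], by simp [triMul], fun t ht => by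
      simpa [triMul] using congrFun ht 3⟩,
    if_pos ⟨![0, 1, 0, 0], ![1, 0, 0, 0], by simp [triMul], by simp [triMul]⟩]

theorem mulInvariant_U1_one : mulInvariant (triMul (0 : F) 1 0 0 1 0 0 1 0 0) = 4 := by
  rw [mulInvariant, if_neg (by simp [triMul]), if_pos
    ⟨![1, 0, 0, 0], ![1, 0, 0, 0], ![1, 0, 0, 0], ![0, 1, 0, 0], by simp [triMul], fun t ht => by
      simpa [triMul] using congrFun ht 3⟩, if_neg]
  rintro ⟨x, y, hx, hxy⟩
  have h2 := congrFun hx 2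
  have h3 := congrFun hx 3
  simp [triMul] at h2 h3
  simp [h2] at h3
  simp [triMul, h2, h3] at hxy

theorem not_exists_not_smul_form (c e k q r s : F) :
    ¬ ∃ x y z w, triMul 0 0 c 0 e k 0 q r s x y ≠ 0 ∧
      ∀ t : F, triMul 0 0 c 0 e k 0 q r s z w ≠ t • triMul 0 0 c 0 e k 0 q r s x y := by
  rintro ⟨x, y, z, w, hne, h⟩
  have h3 : triMul 0 0 c 0 e k 0 q r s x y 3 ≠ 0 := fun h0 => hne <| by
    ext i
    fin_cases i
    · simp [triMul]
    · simp [triMul]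
    · simp [triMul]
    · exact h0
  refine h (triMul 0 0 c 0 e k 0 q r s z w 3 / triMul 0 0 c 0 e k 0 q r s x y 3) ?_
  ext i
  fin_cases i
  · simp [triMul]
  · simp [triMul]
  · simp [triMul]
  · exact (div_mul_cancel₀ _ h3).symm

theorem not_exists_cube_form (c e k q r s : F) :
    ¬ ∃ x y z, triMul 0 0 c 0 e k 0 q r s (triMul 0 0 c 0 e k 0 q r s x y) z ≠ 0 := by
  simp [triMul]

theorem mulInvariant_rank_one : mulInvariant (triMul (0 : F) 0 1 0 0 0 0 0 0 0) = 5 := by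
  rw [mulInvariant, if_neg (not_exists_cube_form _ _ _ _ _ _),
    if_neg (not_exists_not_smul_form _ _ _ _ _ _),
    if_pos ⟨![1, 0, 0, 0], by simp [triMul]⟩, if_neg]
  rintro ⟨x, y, hx, hxy⟩
  have h3 := congrFun hx 3
  simp [triMul] at h3
  simp [triMul, h3] at hxy

theorem mulInvariant_rank_two [IsAlgClosed F] :
    mulInvariant (triMul (0 : F) 0 1 0 0 0 0 1 0 0) = 6 := by
  obtain ⟨ι, hι⟩ := IsAlgClosed.exists_eq_mul_self (-1 : F)
  rw [mulInvariant, if_neg (not_exists_cube_form _ _ _ _ _ _),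
    if_neg (not_exists_not_smul_form _ _ _ _ _ _),
    if_pos ⟨![1, 0, 0, 0], by simp [triMul]⟩,
    if_pos ⟨![1, ι, 0, 0], ![1, 0, 0, 0], by simp [triMul, ← hι], by simp [triMul]⟩,
    if_pos ⟨![0, 0, 1, 0], by simp [triMul], fun y z h => by
      simpa [triMul] using congrFun h 2⟩]

theorem mulInvariant_rank_three [IsAlgClosed F] :
    mulInvariant (triMul (0 : F) 0 1 0 0 0 0 1 0 1) = 7 := by
  obtain ⟨ι, hι⟩ := IsAlgClosed.exists_eq_mul_self (-1 : F)
  rw [mulInvariant, if_neg (not_exists_cube_form _ _ _ _ _ _),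
    if_neg (not_exists_not_smul_form _ _ _ _ _ _),
    if_pos ⟨![1, 0, 0, 0], by simp [triMul]⟩,
    if_pos ⟨![1, ι, 0, 0], ![1, 0, 0, 0], by simp [triMul, ← hι], by simp [triMul]⟩, if_neg]
  rintro ⟨x, hx, hne⟩
  have h0 := congrFun (hx ![1, 0, 0, 0]) 3
  have h1 := congrFun (hx ![0, 1, 0, 0]) 3
  have h2 := congrFun (hx ![0, 0, 1, 0]) 3
  simp [triMul] at h0 h1 h2
  refine hne ![1, 0, 0, 0] ![x 3, 0, 0, 0] ?_
  ext i
  fin_cases i <;> simp [triMul, h0, h1, h2]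

theorem mulInvariant_zero : mulInvariant (triMul (0 : F) 0 0 0 0 0 0 0 0 0) = 8 := by
  rw [mulInvariant, if_neg (not_exists_cube_form _ _ _ _ _ _),
    if_neg (not_exists_not_smul_form _ _ _ _ _ _), if_neg (by simp [triMul]),
    if_neg (by simp [triMul])]

theorem mulInvariant_alternating (h2 : (2 : F) = 0) :
    mulInvariant (triMul (0 : F) 0 0 0 0 0 0 0 1 0) = 9 := by
  rw [mulInvariant, if_neg (not_exists_cube_form _ _ _ _ _ _),
    if_neg (not_exists_not_smul_form _ _ _ _ _ _), if_neg, if_pos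
    ⟨![0, 1, 0, 0], ![0, 0, 1, 0], by simp [triMul]⟩]
  rintro ⟨x, hx⟩
  apply hx
  ext i
  fin_cases i <;> simp [triMul]
  linear_combination (x 1 * x 2) * h2

end Invariants

/-! ### Counting conjugacy classes from a list of representatives -/

section Classes

theorem IsConjSubgroup.refl {G : Type*} [Group G] (R : Subgroup G) : IsConjSubgroup R R :=
  ⟨1, by ext; simp⟩

theorem IsConjSubgroup.symm {G : Type*} [Group G] {R S : Subgroup G} (h : IsConjSubgroup R S) :
    IsConjSubgroup S R := by
  obtain ⟨g, rfl⟩ := h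
  refine ⟨g⁻¹, ?_⟩
  rw [Subgroup.map_map]
  convert Subgroup.map_id R
  ext x
  simp [mul_assoc]

theorem IsConjSubgroup.trans {G : Type*} [Group G] {R S T : Subgroup G} (h : IsConjSubgroup R S)
    (h' : IsConjSubgroup S T) : IsConjSubgroup R T := by
  obtain ⟨g, rfl⟩ := h
  obtain ⟨g', rfl⟩ := h'
  refine ⟨g' * g, ?_⟩
  rw [Subgroup.map_map]
  congr 1
  ext x
  simp

theorem RepresentsAbelianRegularClasses.ncard_eq {n k : ℕ} {F : Type*} [Field F]
    {L : Fin k → Subgroup (AGL n F)} (hL : RepresentsAbelianRegularClasses L) :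
    (abelianRegularClasses n F).ncard = k := by
  obtain ⟨hab, hrep⟩ := hL
  have hrange : abelianRegularClasses n F = Set.range fun i => {S | IsConjSubgroup (L i) S} := by
    ext C
    constructor
    · rintro ⟨R, hR, rfl⟩
      obtain ⟨i, hi, -⟩ := hrep R hR
      exact ⟨i, Set.ext fun S => ⟨fun h => hi.trans h, fun h => hi.symm.trans h⟩⟩
    · rintro ⟨i, rfl⟩
      exact ⟨L i, hab i, rfl⟩
  have hinj : Function.Injective fun i => {S | IsConjSubgroup (L i) S} := by
    intro i j hij
    have h : IsConjSubgroup (L i) (L j) := by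
      have hj : L j ∈ {S | IsConjSubgroup (L j) S} := IsConjSubgroup.refl _
      rw [← show {S | IsConjSubgroup (L i) S} = {S | IsConjSubgroup (L j) S} from hij] at hj
      exact hj
    exact (hrep _ (hab i)).unique (IsConjSubgroup.refl _) h
  rw [hrange, ← Set.image_univ, Set.ncard_image_of_injective _ hinj, Set.ncard_univ,
    Nat.card_fin]

/-- A list of subgroups of `AGL_4(F)` induced by multiplications that exhaust the normal forms and
have distinct invariants represents the classes of abelian regular subgroups. -/
theorem representsAbelianRegularClasses_of_mul {F : Type*} [Field F] [IsAlgClosed F] {k : ℕ}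
    {L : Fin k → Subgroup (AGL 4 F)} (m : Fin k → (Fin 4 → F) → (Fin 4 → F) → (Fin 4 → F))
    (ν : Fin k → ℕ) (hab : ∀ i, IsAbelianRegular (L i)) (hind : ∀ i, InducesSubgroup (m i) (L i))
    (hν : Function.Injective ν) (hinv : ∀ i, mulInvariant (m i) = ν i)
    (hex : ∀ m', HasNormalForm m' → ∃ i, MulIso m' (m i)) (hzero : ∀ i w, m i 0 w = 0) :
    RepresentsAbelianRegularClasses L := by
  refine ⟨hab, fun R hR => ?_⟩
  obtain ⟨m', hcomm, hassoc, hnil, hm'⟩ := hR.exists_inducesSubgroup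
  obtain ⟨i, hi⟩ := hex _ (hasNormalForm_of_isNilpotent m' hcomm hassoc hnil)
  refine ⟨i, hi.isConjSubgroup hm' (hind i), fun j hj => hν ?_⟩
  -- Both listed algebras are isomorphic to the algebra of R, so their invariants agree.
  rw [← hinv, ← hinv, ← (hj.mulIso hR.2 hm' (hind j) (by simp) (hzero j)).mulInvariant_eq,
    hi.mulInvariant_eq]

end Classes

/-! ### The two lists of representatives -/

section Lists

variable {F : Type*} [Field F]

theorem triMul_zero_left (a b c d e k p q r s : F) (w : Fin 4 → F) :
    triMul a b c d e k p q r s 0 w = 0 := by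
  ext i
  fin_cases i <;> simp [triMul]

/-- In the algebra of U₁(0, 1) put f = e₁ - e₂. Then f² = 2e₃ - 2e₄ = (2e₁)f, so 2e₁, f, (2e₁)² and
f² satisfy the relations of U₁(1, 0). Their determinant is 16, so they form a basis exactly when 2 ≠
0. -/
theorem mulIso_U1_of_two_ne_zero (h2 : (2 : F) ≠ 0) :
    MulIso (triMul (0 : F) 1 0 0 1 0 0 1 0 0) (triMul 0 1 0 0 1 0 1 0 0 0) := by
  have h4 : (4 : F) ≠ 0 := by
    rw [show (4 : F) = 2 * 2 by norm_num]
    exact mul_ne_zero h2 h2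
  refine MulIso.triMul_of_matrix !![2, 0, 0, 0; 1, -1, 0, 0; 0, 0, 4, 0; 0, 0, 2, -2]
    !![2⁻¹, 0, 0, 0; 2⁻¹, -1, 0, 0; 0, 0, 4⁻¹, 0; 0, 0, 4⁻¹, -2⁻¹] ?_ ?_ ?_ ?_ ?_ ?_ ?_ ?_
  · ext i j
    fin_cases i <;> fin_cases j <;>
      simp [Matrix.mul_apply, Fin.sum_univ_four] <;> field_simp
  on_goal 7 => intro i; fin_cases i
  all_goals
    ext j
    fin_cases j <;> simp [triMul] <;> norm_num

theorem isSymm_single_same (i : Fin 3) : (elemMatrix3 F i i).IsSymm := by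
  simp [Matrix.IsSymm]

theorem isSymm_single_add_single (i j : Fin 3) :
    (elemMatrix3 F i j + elemMatrix3 F j i).IsSymm := by
  simp [Matrix.IsSymm, add_comm]

variable (F)

theorem inducesSubgroup_rank_one :
    InducesSubgroup (triMul (0 : F) 0 1 0 0 0 0 0 0 0) (subgroupRD (elemMatrix3 F 0 0)) := by
  simpa using inducesSubgroup_subgroupRD (isSymm_single_same (F := F) 0)

theorem inducesSubgroup_rank_two :
    InducesSubgroup (triMul (0 : F) 0 1 0 0 0 0 1 0 0)
      (subgroupRD (elemMatrix3 F 0 0 + elemMatrix3 F 1 1)) := by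
  simpa using inducesSubgroup_subgroupRD
    ((isSymm_single_same (F := F) 0).add (isSymm_single_same 1))

theorem inducesSubgroup_rank_three :
    InducesSubgroup (triMul (0 : F) 0 1 0 0 0 0 1 0 1)
      (subgroupRD (1 : Matrix (Fin 3) (Fin 3) F)) := by
  simpa using inducesSubgroup_subgroupRD (Matrix.isSymm_one (n := Fin 3) (α := F))

theorem inducesSubgroup_alternating :
    InducesSubgroup (triMul (0 : F) 0 0 0 0 0 0 0 1 0)
      (subgroupRD (elemMatrix3 F 1 2 + elemMatrix3 F 2 1)) := by
  simpa using inducesSubgroup_subgroupRD (isSymm_single_add_single (F := F) 1 2)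

theorem representsAbelianRegularClasses_of_two_ne_zero [IsAlgClosed F] (h2 : (2 : F) ≠ 0) :
    RepresentsAbelianRegularClasses
      ![subgroupS5 F, subgroupS41 F, subgroupS32sharp F,
        subgroupU1 (0 : F) 0, subgroupU1 (0 : F) 1,
        subgroupRD (elemMatrix3 F 0 0),
        subgroupRD (elemMatrix3 F 0 0 + elemMatrix3 F 1 1),
        subgroupRD (1 : Matrix (Fin 3) (Fin 3) F),
        subgroupTr4 F] := by
  refine representsAbelianRegularClasses_of_mul
    ![triMul 1 0 0 1 0 1 0 1 0 0, triMul 1 0 0 1 0 0 0 0 0 0, triMul 1 0 0 0 1 0 0 0 0 1,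
      triMul 0 1 0 0 1 0 0 0 0 0, triMul 0 1 0 0 1 0 1 0 0 0, triMul 0 0 1 0 0 0 0 0 0 0,
      triMul 0 0 1 0 0 0 0 1 0 0, triMul 0 0 1 0 0 0 0 1 0 1, triMul 0 0 0 0 0 0 0 0 0 0]
    (fun i => i) ?_ ?_ Fin.val_injective ?_ ?_ ?_
  · intro i
    fin_cases i
    · exact isAbelianRegular_subgroupS5 F
    · exact isAbelianRegular_subgroupS41 F
    · exact isAbelianRegular_subgroupS32sharp F
    · exact isAbelianRegular_subgroupU1 _ _
    · exact isAbelianRegular_subgroupU1 _ _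
    · exact isAbelianRegular_subgroupRD (isSymm_single_same 0)
    · exact isAbelianRegular_subgroupRD ((isSymm_single_same 0).add (isSymm_single_same 1))
    · exact isAbelianRegular_subgroupRD Matrix.isSymm_one
    · exact isAbelianRegular_subgroupTr4 F
  · intro i
    fin_cases i
    · exact inducesSubgroup_subgroupS5 F
    · exact inducesSubgroup_subgroupS41 F
    · exact inducesSubgroup_subgroupS32sharp F
    · exact inducesSubgroup_subgroupU1 _ _
    · exact inducesSubgroup_subgroupU1 _ _
    · exact inducesSubgroup_rank_one F
    · exact inducesSubgroup_rank_two F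
    · exact inducesSubgroup_rank_three F
    · exact inducesSubgroup_subgroupTr4 F
  · intro i
    fin_cases i
    · exact mulInvariant_S5
    · exact mulInvariant_S41
    · exact mulInvariant_S32sharp
    · exact mulInvariant_U1_zero
    · exact (mulIso_U1_of_two_ne_zero h2).mulInvariant_eq.symm.trans mulInvariant_U1_one
    · exact mulInvariant_rank_one
    · exact mulInvariant_rank_two
    · exact mulInvariant_rank_three
    · exact mulInvariant_zero
  · rintro m' (h | h | h | h | h | h | h | h | h | ⟨h, -⟩)
    · exact ⟨0, h⟩
    · exact ⟨1, h⟩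
    · exact ⟨2, h⟩
    · exact ⟨3, h⟩
    · exact ⟨4, h.trans (mulIso_U1_of_two_ne_zero h2)⟩
    · exact ⟨5, h⟩
    · exact ⟨6, h⟩
    · exact ⟨7, h⟩
    · exact ⟨8, h⟩
    · exact absurd h h2
  · intro i
    fin_cases i <;> exact triMul_zero_left _ _ _ _ _ _ _ _ _ _

theorem representsAbelianRegularClasses_of_two_eq_zero [IsAlgClosed F] (h2 : (2 : F) = 0) :
    RepresentsAbelianRegularClasses
      ![subgroupS5 F, subgroupS41 F, subgroupS32sharp F,
        subgroupU1 (0 : F) 0, subgroupU1 (1 : F) 0,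
        subgroupRD (elemMatrix3 F 0 0),
        subgroupRD (elemMatrix3 F 0 0 + elemMatrix3 F 1 1),
        subgroupRD (elemMatrix3 F 1 2 + elemMatrix3 F 2 1),
        subgroupRD (1 : Matrix (Fin 3) (Fin 3) F),
        subgroupTr4 F] := by
  refine representsAbelianRegularClasses_of_mul
    ![triMul 1 0 0 1 0 1 0 1 0 0, triMul 1 0 0 1 0 0 0 0 0 0, triMul 1 0 0 0 1 0 0 0 0 1,
      triMul 0 1 0 0 1 0 0 0 0 0, triMul 0 1 0 0 1 0 0 1 0 0, triMul 0 0 1 0 0 0 0 0 0 0,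
      triMul 0 0 1 0 0 0 0 1 0 0, triMul 0 0 0 0 0 0 0 0 1 0, triMul 0 0 1 0 0 0 0 1 0 1,
      triMul 0 0 0 0 0 0 0 0 0 0]
    -- The alternating form, of invariant 9, stands before the rank three form in this list.
    ![0, 1, 2, 3, 4, 5, 6, 9, 7, 8] ?_ ?_ (by decide) ?_ ?_ ?_
  · intro i
    fin_cases i
    · exact isAbelianRegular_subgroupS5 F
    · exact isAbelianRegular_subgroupS41 F
    · exact isAbelianRegular_subgroupS32sharp F
    · exact isAbelianRegular_subgroupU1 _ _
    · exact isAbelianRegular_subgroupU1 _ _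
    · exact isAbelianRegular_subgroupRD (isSymm_single_same 0)
    · exact isAbelianRegular_subgroupRD ((isSymm_single_same 0).add (isSymm_single_same 1))
    · exact isAbelianRegular_subgroupRD (isSymm_single_add_single 1 2)
    · exact isAbelianRegular_subgroupRD Matrix.isSymm_one
    · exact isAbelianRegular_subgroupTr4 F
  · intro i
    fin_cases i
    · exact inducesSubgroup_subgroupS5 F
    · exact inducesSubgroup_subgroupS41 F
    · exact inducesSubgroup_subgroupS32sharp F
    · exact inducesSubgroup_subgroupU1 _ _
    · exact inducesSubgroup_subgroupU1 _ _
    · exact inducesSubgroup_rank_one F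
    · exact inducesSubgroup_rank_two F
    · exact inducesSubgroup_alternating F
    · exact inducesSubgroup_rank_three F
    · exact inducesSubgroup_subgroupTr4 F
  · intro i
    fin_cases i
    · exact mulInvariant_S5
    · exact mulInvariant_S41
    · exact mulInvariant_S32sharp
    · exact mulInvariant_U1_zero
    · exact mulInvariant_U1_one
    · exact mulInvariant_rank_one
    · exact mulInvariant_rank_two
    · exact mulInvariant_alternating h2
    · exact mulInvariant_rank_three
    · exact mulInvariant_zero
  · rintro m' (h | h | h | h | h | h | h | h | h | ⟨-, h⟩)
    · exact ⟨0, h⟩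
    · exact ⟨1, h⟩
    · exact ⟨2, h⟩
    · exact ⟨3, h⟩
    · exact ⟨4, h⟩
    · exact ⟨5, h⟩
    · exact ⟨6, h⟩
    · exact ⟨8, h⟩
    · exact ⟨9, h⟩
    · exact ⟨7, h⟩
  · intro i
    fin_cases i <;> exact triMul_zero_left _ _ _ _ _ _ _ _ _ _

end Lists

theorem mainTheorem6 (F : Type*) [Field F] [IsAlgClosed F] :
    (ringChar F ≠ 2 →
      (abelianRegularClasses 4 F).ncard = 9 ∧
      RepresentsAbelianRegularClasses
        ![subgroupS5 F, subgroupS41 F, subgroupS32sharp F,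
          subgroupU1 (0 : F) 0, subgroupU1 (0 : F) 1,
          subgroupRD (elemMatrix3 F 0 0),
          subgroupRD (elemMatrix3 F 0 0 + elemMatrix3 F 1 1),
          subgroupRD (1 : Matrix (Fin 3) (Fin 3) F),
          subgroupTr4 F]) ∧
    (ringChar F = 2 →
      (abelianRegularClasses 4 F).ncard = 10 ∧
      RepresentsAbelianRegularClasses
        ![subgroupS5 F, subgroupS41 F, subgroupS32sharp F,
          subgroupU1 (0 : F) 0, subgroupU1 (1 : F) 0,
          subgroupRD (elemMatrix3 F 0 0),
          subgroupRD (elemMatrix3 F 0 0 + elemMatrix3 F 1 1),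
          subgroupRD (elemMatrix3 F 1 2 + elemMatrix3 F 2 1),
          subgroupRD (1 : Matrix (Fin 3) (Fin 3) F),
          subgroupTr4 F]) := by
  constructor
  · intro h
    have hL := representsAbelianRegularClasses_of_two_ne_zero F (Ring.two_ne_zero h)
    exact ⟨hL.ncard_eq, hL⟩
  · intro h
    have h2 : (2 : F) = 0 := by
      have := (ringChar.spec F 2).mpr (by rw [h])
      exact_mod_cast this
    have hL := representsAbelianRegularClasses_of_two_eq_zero F h2
    exact ⟨hL.ncard_eq, hL⟩
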